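/- Let $D_r\subset\mathbb R^2$ be the open disc of radius $r$ about the origin, and let $\slashed\partial=e_1\cdot\partial_1+e_2\cdot\partial_2$ be the flat Dirac operator on functions with values in $\mathbb C^2\otimes\mathbb R^q$, where $e_1,e_2$ act on the factor $\mathbb C^2$ by the skew-Hermitian matrices $\begin{pmatrix}0&1\\-1&0\end{pmatrix}$ and $\begin{pmatrix}0&i\\i&0\end{pmatrix}$, which satisfy the Clifford relations $e_\alpha e_\beta+e_\beta e_\alpha=-2\delta_{\alpha\beta}$. For every $q$ there is an $\epsilon>0$ such that for every $4<p<\infty$ there is a constant $C$, depending only on $p$ and $q$, with the following property. Let $\psi\in L^4(D_1,\mathbb C^2\otimes\mathbb R^q)$ and let $A\in L^2(D_1,\operatorname{End}_{\mathbb R}(\mathbb C^2\otimes\mathbb R^q))$, with the pointwise operator norm. (This includes the fields $A\in L^2(D_1,\mathfrak{gl}(q)\otimes\mathbb R^2)$ acting by $A\psi=A_\alpha\,e_\alpha\cdot\psi$, and fields that act through complex $q\times q$ matrices.) Suppose that $\psi$ solves $\slashed\partial\psi=A\psi$ weakly on $D_1$, that is, $$\int_{D_1}\langle\psi,\slashed\partial\eta\rangle=\int_{D_1}\langle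 A\psi,\eta\rangle\qquad\text{for all }\eta\in C_c^\infty(D_1,\mathbb C^2\otimes\mathbb R^q),$$ and that $\|A\|_{L^2(D_1)}\le\epsilon$. Then $\psi\in L^p(D_{1/16})$ and $$\|\psi\|_{L^p(D_{1/16})}\le C\,\|\psi\|_{L^4(D_1)}.$$ -/

import Mathlib

open MeasureTheory
open scoped ENNReal NNReal ContDiff

/-- The Euclidean plane. -/
abbrev Plane : Type := EuclideanSpace ℝ (Fin 2)

/-- The fibre `ℂ² ⊗ ℝ^q` with its Hermitian inner product. The first index is the spinor index,
the second one is the index of the vector `(ψ¹, …, ψ^q)` of spinors. -/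
abbrev VectorSpinor (q : ℕ) : Type := EuclideanSpace ℂ (Fin 2 × Fin q)

/-- The open disc `D_r` of radius `r` about the origin. -/
abbrev Disc (r : ℝ) : Set Plane := Metric.ball 0 r

/-- The matrices of Clifford multiplication by the standard basis vectors `e₁, e₂` of the plane on
the spinor space `ℂ²`. -/
def cliffordMatrix : Fin 2 → Matrix (Fin 2) (Fin 2) ℂ :=
  ![!![0, 1; -1, 0], !![0, Complex.I; Complex.I, 0]]

/-- The Clifford relations `e_α e_β + e_β e_α = -2 δ_αβ`. -/
theorem cliffordMatrix_relation (α β : Fin 2) :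
    cliffordMatrix α * cliffordMatrix β + cliffordMatrix β * cliffordMatrix α
      = if α = β then -2 else 0 := by
  fin_cases α <;> fin_cases β <;> ext i j <;> fin_cases i <;> fin_cases j <;>
    norm_num [cliffordMatrix, Matrix.mul_apply, Fin.sum_univ_two, Matrix.ofNat_apply,
      Matrix.neg_apply]

/-- Clifford multiplication by a basis vector is skew-Hermitian. -/
theorem cliffordMatrix_skew (α : Fin 2) :
    (cliffordMatrix α).conjTranspose = -cliffordMatrix α := by
  fin_cases α <;> ext i j <;> fin_cases i <;> fin_cases j <;>
    simp [cliffordMatrix, Matrix.conjTranspose_apply]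

/-- Clifford multiplication `e_α · v` on `ℂ² ⊗ ℝ^q`; it acts on the factor `ℂ²`. -/
noncomputable def cliffordMul {q : ℕ} (α : Fin 2) (v : VectorSpinor q) : VectorSpinor q :=
  WithLp.toLp 2 fun i => ∑ b : Fin 2, cliffordMatrix α i.1 b * v (b, i.2)

/-- The flat Dirac operator `∑_α e_α · ∂_α η` on differentiable maps `η : ℝ² → ℂ² ⊗ ℝ^q`. -/
noncomputable def diracOp {q : ℕ} (η : Plane → VectorSpinor q) (x : Plane) : VectorSpinor q :=
  ∑ α : Fin 2, cliffordMul α (fderiv ℝ η x (EuclideanSpace.single α 1))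

/-- `ψ` is a weak solution on the open set `U` of the Dirac equation with right-hand side `A ψ`:
since the Dirac operator is formally self-adjoint, this means `∫ ⟨ψ, ∂̸η⟩ = ∫ ⟨Aψ, η⟩` for all
smooth `η` with compact support in `U`. -/
def IsWeakDiracSolution {q : ℕ} (U : Set Plane)
    (A : Plane → VectorSpinor q →L[ℝ] VectorSpinor q) (ψ : Plane → VectorSpinor q) : Prop :=
  ∀ η : Plane → VectorSpinor q, ContDiff ℝ ∞ η → HasCompactSupport η → tsupport η ⊆ U →
    ∫ x in U, inner ℂ (ψ x) (diracOp η x) = ∫ x in U, inner ℂ (A x (ψ x)) (η x)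

/-! Cut off by a bump `χ` and test the equation against `χ` times a regularised fundamental
solution. As the regularisation is removed, this shows that `v = |χψ|` satisfies `v ≤ c N + c I(a
v)` almost everywhere (`ae_enorm_discCutoff_smul_le`). Here `a = |A|`, `N` is the `L⁴` norm of `ψ`,
and `I` is convolution with `|x|⁻¹`. The term with `∇χ` is absorbed into `c N` by Hölder. From here
on only this scalar inequality matters.

Testing it against `v³` on a ball and using Hardy-Littlewood-Sobolev compares the `L⁴` norms of `v`
on two concentric balls (`ballLFour_le_of_le_potential`). The near part of the potential costs a
factor `c C ‖a‖₂`; the far part is controlled by its value at the centre. Let `Y k` be the `L⁴` norm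
on the ball of radius `2⁻ᵏ` times `2^(k/2)`, and `α k` the `L²` norm of `a` on the `k`-th dyadic
annulus. Smallness of `a` is used once, to give `4 Y (k+1) ≤ A + K ∑ α j Y j + 2 Y k`. A discrete
Gronwall argument bounds `Y k` by `M ∏ (1 + K α j)`. Since `∑ α j² ≤ ‖a‖₂²`, Cauchy-Schwarz bounds
this by `M exp (K ‖a‖₂ √k)` (`ballLFour_dyadic_le`).

This growth is slower than `2^(τ k)` for every `τ > 0`, with no further smallness, and so `ε` does
not depend on `p`. The mass of `a v` on balls of radius `2⁻ᵏ` is thus `O(2^(-(1-τ) k))`. Given `p`,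
a small `τ` makes this Morrey decay sufficient to put the potential of `a v` in `L^p`
(`lintegral_disc_potential_rpow_le`), and hence `v` as well. -/

/-! ### Powers of the distance on balls and their complements -/

theorem Plane.lintegral_eq_mul_lintegral_add_smul (f : Plane → ℝ≥0∞) (x : Plane) {r : ℝ}
    (hr : 0 < r) : ∫⁻ y, f y = ENNReal.ofReal (r ^ 2) * ∫⁻ z, f (x + r • z) := by
  rw [← lintegral_add_left_eq_self f x]
  have h := Measure.map_addHaar_smul (volume : Measure Plane) hr.ne'
  have h2 : (∫⁻ y, f (x + y) ∂(Measure.map (r • ·) (volume : Measure Plane)))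
      = ∫⁻ z, f (x + r • z) :=
    (Homeomorph.smulOfNeZero r hr.ne').toMeasurableEquiv.measurableEmbedding.lintegral_map _
  rw [← h2, h, lintegral_smul_measure, smul_eq_mul, ← mul_assoc, finrank_euclideanSpace_fin,
    abs_of_nonneg (by positivity), ← ENNReal.ofReal_mul (by positivity),
    mul_inv_cancel₀ (by positivity), ENNReal.ofReal_one, one_mul]

theorem Plane.edist_add_smul_rpow_neg (x z : Plane) {r s : ℝ} (hr : 0 < r) (hs : 0 ≤ s) :
    edist x (x + r • z) ^ (-s) = ENNReal.ofReal (r ^ (-s)) * ‖z‖ₑ ^ (-s) := by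
  have h : edist x (x + r • z) = ENNReal.ofReal r * ‖z‖ₑ := by
    rw [edist_comm, edist_eq_enorm_sub, add_sub_cancel_left, enorm_smul,
      Real.enorm_of_nonneg hr.le]
  have hr0 : ENNReal.ofReal r ^ s ≠ 0 := by
    simp [ENNReal.rpow_eq_zero_iff, hr, not_lt.2 hs]
  have hrt : ENNReal.ofReal r ^ s ≠ ⊤ := ENNReal.rpow_ne_top_of_nonneg hs ENNReal.ofReal_ne_top
  rw [h, ENNReal.rpow_neg, ENNReal.mul_rpow_of_nonneg _ _ hs,
    ENNReal.mul_inv (Or.inl hr0) (Or.inl hrt), ← ENNReal.rpow_neg, ← ENNReal.rpow_neg,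
    ENNReal.ofReal_rpow_of_pos hr]

/-- Scaling: the substitution `y = x + r z` contributes `r²` from the Jacobian and `r^(-s)` from the
kernel. It reduces balls and their complements to radius one. -/
theorem Plane.lintegral_edist_rpow_indicator_eq (x : Plane) {r s : ℝ} (hr : 0 < r) (hs : 0 ≤ s)
    (S : Set Plane) (T : Set Plane) (hT : MeasurableSet T) (hS : MeasurableSet S)
    (hST : ∀ z, x + r • z ∈ T ↔ z ∈ S) :
    ∫⁻ y in T, edist x y ^ (-s)
      = (∫⁻ z in S, ‖z‖ₑ ^ (-s)) * ENNReal.ofReal (r ^ (2 - s)) := by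
  rw [← lintegral_indicator hT, Plane.lintegral_eq_mul_lintegral_add_smul _ x hr]
  have h : ∀ z, T.indicator (fun y => edist x y ^ (-s)) (x + r • z)
      = ENNReal.ofReal (r ^ (-s)) * S.indicator (fun z => ‖z‖ₑ ^ (-s)) z := by
    intro z
    by_cases hz : z ∈ S
    · rw [Set.indicator_of_mem hz, Set.indicator_of_mem ((hST z).2 hz),
        Plane.edist_add_smul_rpow_neg x z hr hs]
    · rw [Set.indicator_of_notMem hz, Set.indicator_of_notMem (fun h => hz ((hST z).1 h)), mul_zero]
  simp_rw [h]
  rw [lintegral_const_mul' _ _ ENNReal.ofReal_ne_top, lintegral_indicator hS, ← mul_assoc,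
    ← ENNReal.ofReal_mul (by positivity), mul_comm, ← Real.rpow_natCast, ← Real.rpow_add hr,
    sub_eq_add_neg]
  norm_num

theorem Plane.lintegral_ball_edist_rpow_le {s : ℝ} (hs : 0 ≤ s) (hs2 : s < 2) :
    ∃ C : ℝ≥0, ∀ (x : Plane) (r : ℝ), 0 < r →
      ∫⁻ y in Metric.ball x r, edist x y ^ (-s) ≤ C * ENNReal.ofReal (r ^ (2 - s)) := by
  have hfin : ∫⁻ z in Metric.ball (0 : Plane) 1, ‖z‖ₑ ^ (-s) ≠ ⊤ := by
    have hi : IntegrableOn (fun z : Plane => ‖z‖ ^ (-s)) (Metric.ball 0 1) := by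
      refine integrableOn_ball_of_norm_le_rpow (C := 1) (α := s) ?_ ?_ ?_ ?_
      · simp
      · simpa using hs2
      · refine Filter.Eventually.of_forall fun x => ?_
        rw [one_mul, Real.norm_of_nonneg (by positivity)]
      · exact (measurable_norm.pow_const _).aestronglyMeasurable
    have h2 := hi.hasFiniteIntegral
    rw [hasFiniteIntegral_iff_enorm] at h2
    refine ne_of_lt (lt_of_le_of_lt (le_of_eq ?_) h2)
    refine lintegral_congr_ae ?_
    -- The origin has to be dropped: for `s > 0` the power `0 ^ (-s)` is `0` in `ℝ` but `⊤` in
    -- `ℝ≥0∞`.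
    have h0 : ∀ᵐ z : Plane ∂(volume.restrict (Metric.ball 0 1)), z ≠ 0 :=
      ae_restrict_of_ae (by simp [ae_iff])
    filter_upwards [h0] with z hz
    have hz' : 0 < ‖z‖ := norm_pos_iff.2 hz
    rw [Real.enorm_of_nonneg (by positivity), ← ENNReal.ofReal_rpow_of_pos hz', ofReal_norm]
  refine ⟨(∫⁻ z in Metric.ball (0 : Plane) 1, ‖z‖ₑ ^ (-s)).toNNReal, fun x r hr => ?_⟩
  rw [ENNReal.coe_toNNReal hfin, Plane.lintegral_edist_rpow_indicator_eq x hr hs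
    (Metric.ball 0 1) _ measurableSet_ball measurableSet_ball]
  intro z
  simp [norm_smul, abs_of_pos hr, mul_lt_iff_lt_one_right hr]

theorem Plane.lintegral_compl_ball_edist_rpow_le {s : ℝ} (hs2 : 2 < s) :
    ∃ C : ℝ≥0, ∀ (x : Plane) (r : ℝ), 0 < r →
      ∫⁻ y in (Metric.ball x r)ᶜ, edist x y ^ (-s) ≤ C * ENNReal.ofReal (r ^ (2 - s)) := by
  have hs : 0 ≤ s := by linarith
  have hfin : ∫⁻ z in (Metric.ball (0 : Plane) 1)ᶜ, ‖z‖ₑ ^ (-s) ≠ ⊤ := by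
    have hi : Integrable (fun z : Plane => (1 + ‖z‖) ^ (-s)) := by
      refine integrable_one_add_norm ?_
      simpa using hs2
    have h2 := (hi.const_mul (2 ^ s)).restrict (s := (Metric.ball (0 : Plane) 1)ᶜ)
      |>.hasFiniteIntegral
    rw [hasFiniteIntegral_iff_enorm] at h2
    refine ne_of_lt (lt_of_le_of_lt ?_ h2)
    refine setLIntegral_mono' measurableSet_ball.compl fun z hz => ?_
    have hz1 : 1 ≤ ‖z‖ := by simpa using hz
    have hz' : 0 < ‖z‖ := by linarith
    rw [Real.enorm_of_nonneg (by positivity), ← ofReal_norm, ENNReal.ofReal_rpow_of_pos hz']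
    refine ENNReal.ofReal_le_ofReal ?_
    have : (2 * ‖z‖) ^ (-s) ≤ (1 + ‖z‖) ^ (-s) :=
      Real.rpow_le_rpow_of_nonpos (by positivity) (by linarith) (by linarith)
    calc ‖z‖ ^ (-s) = 2 ^ s * (2 * ‖z‖) ^ (-s) := by
          rw [Real.mul_rpow (by norm_num) hz'.le, ← mul_assoc, ← Real.rpow_add (by norm_num)]
          simp
      _ ≤ _ := by gcongr
  refine ⟨(∫⁻ z in (Metric.ball (0 : Plane) 1)ᶜ, ‖z‖ₑ ^ (-s)).toNNReal, fun x r hr => ?_⟩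
  rw [ENNReal.coe_toNNReal hfin, Plane.lintegral_edist_rpow_indicator_eq x hr hs
    (Metric.ball 0 1)ᶜ _ measurableSet_ball.compl measurableSet_ball.compl]
  intro z
  simp [norm_smul, abs_of_pos hr, le_mul_iff_one_le_right hr]

theorem Plane.volume_ball_le (x : Plane) {r : ℝ} (hr : 0 ≤ r) :
    volume (Metric.ball x r) ≤ 4 * ENNReal.ofReal (r ^ 2) := by
  rw [EuclideanSpace.volume_ball]
  simp only [Fintype.card_fin]
  rw [← ENNReal.ofReal_pow hr, mul_comm]
  gcongr
  rw [show (4 : ℝ≥0∞) = ENNReal.ofReal 4 by simp]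
  refine ENNReal.ofReal_le_ofReal ?_
  have : Real.Gamma ((2 : ℕ) / 2 + 1) = 1 := by
    norm_num
  rw [this, Real.sq_sqrt Real.pi_pos.le, div_one]
  exact Real.pi_le_four

/-! ### The Hardy-Littlewood-Sobolev inequality -/

/-- Split the integral at a radius `r`. Inside, the bound `h ≤ l` gives a multiple of `l r`;
outside, Hölder with exponents `4/3` and `4` gives a multiple of `r^(-1/2)`. -/
theorem lintegral_mul_edist_inv_le_of_le_level :
    ∃ C : ℝ≥0, ∀ (h : Plane → ℝ≥0∞) (l : ℝ), Measurable h → 0 < l →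
      (∀ y, h y ≤ ENNReal.ofReal l) → ∫⁻ y, h y ^ (4 / 3 : ℝ) ≤ 1 →
      ∀ x, ∫⁻ y, h y * (edist x y)⁻¹ ≤ C * ENNReal.ofReal (l ^ (1 / 3 : ℝ)) := by
  obtain ⟨C₁, h₁⟩ := Plane.lintegral_ball_edist_rpow_le (s := 1) (by norm_num) (by norm_num)
  obtain ⟨C₂, h₂⟩ := Plane.lintegral_compl_ball_edist_rpow_le (s := 4) (by norm_num)
  refine ⟨C₁ + C₂ ^ (1 / 4 : ℝ), fun h l hm hl hle hint x => ?_⟩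
  -- This radius balances the two parts: `l r = r^(-1/2) = l^(1/3)`.
  set r : ℝ := l ^ (-2 / 3 : ℝ) with hrdef
  have hr : 0 < r := by positivity
  have near : ∫⁻ y in Metric.ball x r, h y * (edist x y)⁻¹
      ≤ C₁ * ENNReal.ofReal (l ^ (1 / 3 : ℝ)) := by
    calc ∫⁻ y in Metric.ball x r, h y * (edist x y)⁻¹
        ≤ ∫⁻ y in Metric.ball x r, ENNReal.ofReal l * edist x y ^ (-1 : ℝ) := by
          refine lintegral_mono fun y => ?_
          rw [ENNReal.rpow_neg_one]
          gcongr
          exact hle y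
      _ = ENNReal.ofReal l * ∫⁻ y in Metric.ball x r, edist x y ^ (-1 : ℝ) :=
          lintegral_const_mul' _ _ ENNReal.ofReal_ne_top
      _ ≤ ENNReal.ofReal l * (C₁ * ENNReal.ofReal (r ^ (2 - 1 : ℝ))) := by
          gcongr
          exact h₁ x r hr
      _ = C₁ * (ENNReal.ofReal l * ENNReal.ofReal (r ^ (2 - 1 : ℝ))) := by ring
      _ = C₁ * ENNReal.ofReal (l ^ (1 / 3 : ℝ)) := by
          rw [← ENNReal.ofReal_mul hl.le, hrdef, ← Real.rpow_mul hl.le]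
          nth_rewrite 1 [← Real.rpow_one l]
          rw [← Real.rpow_add hl]
          norm_num
  have far : ∫⁻ y in (Metric.ball x r)ᶜ, h y * (edist x y)⁻¹
      ≤ (C₂ ^ (1 / 4 : ℝ) : ℝ≥0) * ENNReal.ofReal (l ^ (1 / 3 : ℝ)) := by
    have hH := ENNReal.lintegral_mul_le_Lp_mul_Lq (volume.restrict (Metric.ball x r)ᶜ)
      (p := 4 / 3) (q := 4) (by rw [Real.holderConjugate_iff]; norm_num)
      hm.aemeasurable (g := fun y => (edist x y)⁻¹) (by fun_prop)
    refine hH.trans ?_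
    have e1 : (∫⁻ y in (Metric.ball x r)ᶜ, h y ^ (4 / 3 : ℝ)) ^ (1 / (4 / 3) : ℝ) ≤ 1 :=
      ENNReal.rpow_le_one ((setLIntegral_le_lintegral _ _).trans hint) (by norm_num)
    have e2 : (∫⁻ y in (Metric.ball x r)ᶜ, (edist x y)⁻¹ ^ (4 : ℝ)) ^ (1 / 4 : ℝ)
        ≤ (C₂ ^ (1 / 4 : ℝ) : ℝ≥0) * ENNReal.ofReal (l ^ (1 / 3 : ℝ)) := by
      simp_rw [ENNReal.inv_rpow, ← ENNReal.rpow_neg]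
      refine (ENNReal.rpow_le_rpow (h₂ x r hr) (by norm_num)).trans ?_
      rw [ENNReal.mul_rpow_of_nonneg _ _ (by norm_num), ENNReal.coe_rpow_of_nonneg _ (by norm_num),
        ENNReal.ofReal_rpow_of_pos (by positivity), hrdef, ← Real.rpow_mul hl.le,
        ← Real.rpow_mul hl.le]
      norm_num
    calc _ ≤ 1 * _ := mul_le_mul' e1 e2
      _ = _ := one_mul _
  rw [← lintegral_add_compl _ (measurableSet_ball (x := x) (ε := r)), ENNReal.coe_add, add_mul]
  exact add_le_add near far

/-- For fixed `x`, the truncation of `g` at height `f x` has potential at most `C (f x)^(1/3)`. The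
outer integrand is therefore at most `C (f x)^(4/3)`, and no sum over levels is needed. -/
theorem lintegral_lintegral_mul_edist_inv_restrict_le :
    ∃ C : ℝ≥0, ∀ (f g : Plane → ℝ≥0∞), Measurable f → Measurable g →
      ∫⁻ x, f x ^ (4 / 3 : ℝ) ≤ 1 → ∫⁻ x, g x ^ (4 / 3 : ℝ) ≤ 1 →
      ∫⁻ x, ∫⁻ y, f x * ({y | g y ≤ f x}.indicator g y * (edist x y)⁻¹) ≤ C := by
  obtain ⟨C, hC⟩ := lintegral_mul_edist_inv_le_of_le_level
  refine ⟨C, fun f g hf hg hf1 hg1 => ?_⟩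
  have hfin : ∀ᵐ x, f x ≠ ⊤ := by
    have h := ae_lt_top (hf.pow_const (4 / 3 : ℝ)) (ne_top_of_le_ne_top ENNReal.one_ne_top hf1)
    filter_upwards [h] with x hx hx2
    simp [hx2] at hx
  calc ∫⁻ x, ∫⁻ y, f x * ({y | g y ≤ f x}.indicator g y * (edist x y)⁻¹)
      ≤ ∫⁻ x, C * f x ^ (4 / 3 : ℝ) := by
        refine lintegral_mono_ae ?_
        filter_upwards [hfin] with x hx
        rcases eq_or_ne (f x) 0 with h0 | h0
        · simp [h0]
        have hms : MeasurableSet {y | g y ≤ f x} := measurableSet_le hg measurable_const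
        have hpos : 0 < (f x).toReal := ENNReal.toReal_pos h0 hx
        have hle : ∀ y, {y | g y ≤ f x}.indicator g y ≤ ENNReal.ofReal (f x).toReal := by
          intro y
          rw [ENNReal.ofReal_toReal hx]
          exact Set.indicator_le (s := {y | g y ≤ f x}) (g := fun _ => f x) (fun y hy => hy) y
        have hint : ∫⁻ y, {y | g y ≤ f x}.indicator g y ^ (4 / 3 : ℝ) ≤ 1 := by
          refine (lintegral_mono fun y => ?_).trans hg1
          exact ENNReal.rpow_le_rpow (Set.indicator_le_self _ _ _) (by norm_num)
        rw [lintegral_const_mul' _ _ hx]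
        calc _ ≤ f x * (C * ENNReal.ofReal ((f x).toReal ^ (1 / 3 : ℝ))) := by
              gcongr
              exact hC _ _ (hg.indicator hms) hpos hle hint x
          _ = C * (f x ^ (1 : ℝ) * f x ^ (1 / 3 : ℝ)) := by
              rw [← ENNReal.ofReal_rpow_of_pos hpos, ENNReal.ofReal_toReal hx, ENNReal.rpow_one]
              ring
          _ = C * f x ^ (4 / 3 : ℝ) := by
              rw [← ENNReal.rpow_add _ _ h0 hx]
              norm_num
    _ = C * ∫⁻ x, f x ^ (4 / 3 : ℝ) := lintegral_const_mul' _ _ ENNReal.coe_ne_top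
    _ ≤ C * 1 := by gcongr
    _ = C := mul_one _

/-- The Hardy-Littlewood-Sobolev inequality for the kernel `|x - y|⁻¹` on the plane. -/
theorem lintegral_lintegral_mul_edist_inv_le :
    ∃ C : ℝ≥0, ∀ (f g : Plane → ℝ≥0∞) (M N : ℝ≥0), Measurable f → Measurable g →
      M ≠ 0 → N ≠ 0 → ∫⁻ x, f x ^ (4 / 3 : ℝ) ≤ (M : ℝ≥0∞) ^ (4 / 3 : ℝ) →
      ∫⁻ x, g x ^ (4 / 3 : ℝ) ≤ (N : ℝ≥0∞) ^ (4 / 3 : ℝ) →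
      ∫⁻ x, f x * ∫⁻ y, g y * (edist x y)⁻¹ ≤ C * M * N := by
  obtain ⟨C, hC⟩ := lintegral_lintegral_mul_edist_inv_restrict_le
  have unit : ∀ (f g : Plane → ℝ≥0∞), Measurable f → Measurable g →
      ∫⁻ x, f x ^ (4 / 3 : ℝ) ≤ 1 → ∫⁻ x, g x ^ (4 / 3 : ℝ) ≤ 1 →
      ∫⁻ x, f x * ∫⁻ y, g y * (edist x y)⁻¹ ≤ C + C := by
    intro f g hf hg hf1 hg1
    have hke : Measurable fun p : Plane × Plane => (edist p.1 p.2)⁻¹ := by fun_prop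
    have hA : Measurable fun p : Plane × Plane =>
        f p.1 * ({y | g y ≤ f p.1}.indicator g p.2 * (edist p.1 p.2)⁻¹) := by
      have hind : Measurable fun p : Plane × Plane => {y | g y ≤ f p.1}.indicator g p.2 :=
        (hg.comp measurable_snd).indicator
          (measurableSet_le (hg.comp measurable_snd) (hf.comp measurable_fst))
      exact (hf.comp measurable_fst).mul (hind.mul hke)
    have hB : Measurable fun p : Plane × Plane =>
        g p.2 * ({x | f x ≤ g p.2}.indicator f p.1 * (edist p.2 p.1)⁻¹) := by
      have hind : Measurable fun p : Plane × Plane => {x | f x ≤ g p.2}.indicator f p.1 :=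
        (hf.comp measurable_fst).indicator
          (measurableSet_le (hf.comp measurable_fst) (hg.comp measurable_snd))
      exact (hg.comp measurable_snd).mul (hind.mul (by fun_prop))
    calc ∫⁻ x, f x * ∫⁻ y, g y * (edist x y)⁻¹
        = ∫⁻ x, ∫⁻ y, f x * (g y * (edist x y)⁻¹) := by
          refine lintegral_congr fun x => ?_
          rw [lintegral_const_mul]
          fun_prop
      -- At each pair either `g y ≤ f x` or `f x ≤ g y`. The kernel is symmetric, so the second case
      -- is the first with `f` and `g` exchanged.
      _ ≤ ∫⁻ x, ∫⁻ y, (f x * ({y | g y ≤ f x}.indicator g y * (edist x y)⁻¹)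
            + g y * ({x | f x ≤ g y}.indicator f x * (edist y x)⁻¹)) := by
          refine lintegral_mono fun x => lintegral_mono fun y => ?_
          rcases le_total (g y) (f x) with h | h
          · refine le_add_right (le_of_eq ?_)
            rw [Set.indicator_of_mem (s := {y | g y ≤ f x}) h]
          · refine le_add_left (le_of_eq ?_)
            rw [Set.indicator_of_mem (s := {x | f x ≤ g y}) h, edist_comm]
            ring
      _ = ∫⁻ x, ((∫⁻ y, f x * ({y | g y ≤ f x}.indicator g y * (edist x y)⁻¹))
            + ∫⁻ y, g y * ({x | f x ≤ g y}.indicator f x * (edist y x)⁻¹)) := by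
          refine lintegral_congr fun x => ?_
          exact lintegral_add_left (hA.comp measurable_prodMk_left) _
      _ = (∫⁻ x, ∫⁻ y, f x * ({y | g y ≤ f x}.indicator g y * (edist x y)⁻¹))
            + ∫⁻ x, ∫⁻ y, g y * ({x | f x ≤ g y}.indicator f x * (edist y x)⁻¹) :=
          lintegral_add_left hA.lintegral_prod_right' _
      _ = (∫⁻ x, ∫⁻ y, f x * ({y | g y ≤ f x}.indicator g y * (edist x y)⁻¹))
            + ∫⁻ y, ∫⁻ x, g y * ({x | f x ≤ g y}.indicator f x * (edist y x)⁻¹) := by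
          congr 1
          exact lintegral_lintegral_swap hB.aemeasurable
      _ ≤ C + C := add_le_add (hC f g hf hg hf1 hg1) (hC g f hg hf hg1 hf1)
  refine ⟨C + C, fun f g M N hf hg hM hN hfM hgN => ?_⟩
  -- Both sides are homogeneous, so each function can be normalised in `L^(4/3)`.
  have scale : ∀ (h : Plane → ℝ≥0∞) (K : ℝ≥0), K ≠ 0 →
      ∫⁻ x, h x ^ (4 / 3 : ℝ) ≤ (K : ℝ≥0∞) ^ (4 / 3 : ℝ) →
      ∫⁻ x, ((K : ℝ≥0∞)⁻¹ * h x) ^ (4 / 3 : ℝ) ≤ 1 := by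
    intro h K hK hle
    have hK' : (K : ℝ≥0∞) ≠ 0 := by simpa using hK
    simp_rw [ENNReal.mul_rpow_of_nonneg _ _ (show (0 : ℝ) ≤ 4 / 3 by norm_num)]
    rw [lintegral_const_mul' _ _ (ENNReal.rpow_ne_top_of_nonneg (by norm_num)
      (ENNReal.inv_ne_top.2 hK'))]
    calc _ ≤ (K : ℝ≥0∞)⁻¹ ^ (4 / 3 : ℝ) * (K : ℝ≥0∞) ^ (4 / 3 : ℝ) := by gcongr
      _ = 1 := by
        rw [← ENNReal.mul_rpow_of_nonneg _ _ (by norm_num),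
          ENNReal.inv_mul_cancel hK' ENNReal.coe_ne_top, ENNReal.one_rpow]
  have key := unit (fun x => (M : ℝ≥0∞)⁻¹ * f x) (fun x => (N : ℝ≥0∞)⁻¹ * g x)
    (hf.const_mul _) (hg.const_mul _) (scale f M hM hfM) (scale g N hN hgN)
  have hM' : (M : ℝ≥0∞) ≠ 0 := by simpa using hM
  have hN' : (N : ℝ≥0∞) ≠ 0 := by simpa using hN
  have e : ∫⁻ x, f x * ∫⁻ y, g y * (edist x y)⁻¹ = M * N *
      ∫⁻ x, (M : ℝ≥0∞)⁻¹ * f x * ∫⁻ y, (N : ℝ≥0∞)⁻¹ * g y * (edist x y)⁻¹ := by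
    rw [← lintegral_const_mul' _ _ (by finiteness)]
    refine lintegral_congr fun x => ?_
    simp_rw [mul_assoc (N : ℝ≥0∞)⁻¹]
    rw [lintegral_const_mul' _ _ (ENNReal.inv_ne_top.2 hN')]
    calc _ = (M * (M : ℝ≥0∞)⁻¹) * (N * (N : ℝ≥0∞)⁻¹) * (f x * ∫⁻ y, g y * (edist x y)⁻¹) := by
          rw [ENNReal.mul_inv_cancel hM' ENNReal.coe_ne_top,
            ENNReal.mul_inv_cancel hN' ENNReal.coe_ne_top, one_mul, one_mul]
      _ = _ := by ring
  rw [e, ENNReal.coe_add]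
  calc _ ≤ (M : ℝ≥0∞) * N * (C + C) := by gcongr
    _ = _ := by ring

/-! ### Local `L⁴` norms of subsolutions -/

/-- The `L⁴` norm of a nonnegative function on the ball of radius `r` about `x`. -/
noncomputable def ballLFour (v : Plane → ℝ≥0∞) (x : Plane) (r : ℝ) : ℝ≥0∞ :=
  (∫⁻ y in Metric.ball x r, v y ^ (4 : ℝ)) ^ (1 / 4 : ℝ)

theorem ballLFour_rpow_four (v : Plane → ℝ≥0∞) (x : Plane) (r : ℝ) :
    ballLFour v x r ^ (4 : ℝ) = ∫⁻ y in Metric.ball x r, v y ^ (4 : ℝ) := by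
  rw [ballLFour, ← ENNReal.rpow_mul]
  norm_num

theorem ballLFour_mono (v : Plane → ℝ≥0∞) (x : Plane) {r s : ℝ} (h : r ≤ s) :
    ballLFour v x r ≤ ballLFour v x s :=
  ENNReal.rpow_le_rpow (lintegral_mono_set (Metric.ball_subset_ball h)) (by norm_num)

theorem ballLFour_le_of_lintegral_le {v : Plane → ℝ≥0∞} {N : ℝ≥0}
    (hN : ∫⁻ y, v y ^ (4 : ℝ) ≤ (N : ℝ≥0∞) ^ (4 : ℝ)) (x : Plane) (r : ℝ) :
    ballLFour v x r ≤ N := by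
  have h := ENNReal.rpow_le_rpow ((setLIntegral_le_lintegral (Metric.ball x r) _).trans hN)
    (show (0 : ℝ) ≤ 1 / 4 by norm_num)
  rw [← ENNReal.rpow_mul] at h
  norm_num at h
  simpa [ballLFour] using h

/-- Hölder for `v³ · 1` with exponents `4/3` and `4`. It controls the constant terms once the
inequality for `v` is tested against `v³`. -/
theorem setLIntegral_rpow_three_le {v : Plane → ℝ≥0∞} (hv : Measurable v) (x : Plane) {r : ℝ}
    (hr : 0 < r) : ∫⁻ y in Metric.ball x r, v y ^ (3 : ℝ)
      ≤ ballLFour v x r ^ (3 : ℝ) * (2 * ENNReal.ofReal (r ^ (1 / 2 : ℝ))) := by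
  have hH := ENNReal.lintegral_mul_le_Lp_mul_Lq (volume.restrict (Metric.ball x r))
      (p := 4 / 3) (q := 4) (by rw [Real.holderConjugate_iff]; norm_num)
      (hv.pow_const (3 : ℝ)).aemeasurable (g := fun _ => 1) aemeasurable_const
  simp only [Pi.mul_apply, mul_one, ENNReal.one_rpow, lintegral_const, one_mul,
    Measure.restrict_apply_univ, ← ENNReal.rpow_mul] at hH
  refine hH.trans (mul_le_mul' (le_of_eq ?_) ?_)
  · rw [ballLFour, ← ENNReal.rpow_mul]
    norm_num
  · refine (ENNReal.rpow_le_rpow (Plane.volume_ball_le x hr.le) (by norm_num)).trans ?_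
    rw [ENNReal.mul_rpow_of_nonneg _ _ (by norm_num), ENNReal.ofReal_rpow_of_pos (by positivity),
      ← Real.rpow_natCast, ← Real.rpow_mul hr.le]
    refine mul_le_mul' ?_ (le_of_eq (by norm_num))
    calc (4 : ℝ≥0∞) ^ (1 / 4 : ℝ) ≤ 4 ^ (1 / 2 : ℝ) :=
          ENNReal.rpow_le_rpow_of_exponent_le (by norm_num) (by norm_num)
      _ = 2 := by
        rw [show (4 : ℝ≥0∞) = 2 ^ (2 : ℝ) by norm_num, ← ENNReal.rpow_mul]
        norm_num

/-- The comparison of the local `L⁴` norms of a subsolution on two concentric balls. -/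
theorem ballLFour_le_of_le_potential :
    ∃ C : ℝ≥0, ∀ (v a : Plane → ℝ≥0∞) (G c e N : ℝ≥0), Measurable v → Measurable a →
      ∫⁻ y, v y ^ (4 : ℝ) ≤ (N : ℝ≥0∞) ^ (4 : ℝ) → ∫⁻ y, a y ^ (2 : ℝ) ≤ (e : ℝ≥0∞) ^ (2 : ℝ) →
      e ≠ 0 → (∀ᵐ x, v x ≤ G + c * ∫⁻ y, a y * v y * (edist x y)⁻¹) →
      ∀ (x₀ : Plane) (r : ℝ), 0 < r →
      ballLFour v x₀ r ≤ 2 * ENNReal.ofReal (r ^ (1 / 2 : ℝ)) * (G + 2 * c *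
          ∫⁻ y in (Metric.ball x₀ (2 * r))ᶜ, a y * v y * (edist x₀ y)⁻¹)
        + c * C * e * ballLFour v x₀ (2 * r) := by
  obtain ⟨C, hC⟩ := lintegral_lintegral_mul_edist_inv_le
  refine ⟨C, fun v a G c e N hv ha hvN hae he hsub x₀ r hr => ?_⟩
  set F : ℝ≥0∞ := ∫⁻ y in (Metric.ball x₀ (2 * r))ᶜ, a y * v y * (edist x₀ y)⁻¹ with hF
  set V := ballLFour v x₀ r with hV
  set W := ballLFour v x₀ (2 * r) with hW
  have hVW : V ≤ W := ballLFour_mono v x₀ (by linarith)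
  have hWt : W ≠ ⊤ := ne_top_of_le_ne_top ENNReal.coe_ne_top (ballLFour_le_of_lintegral_le hvN _ _)
  have hVt : V ≠ ⊤ := ne_top_of_le_ne_top hWt hVW
  -- The argument ends by cancelling `V³`, so `V` must be neither `0` nor `⊤`.
  rcases eq_or_ne V 0 with hV0 | hV0
  · rw [hV0]; exact zero_le
  have hW0 : W ≠ 0 := fun h => hV0 (le_antisymm (h ▸ hVW) zero_le)
  set B := Metric.ball x₀ r
  set B' := Metric.ball x₀ (2 * r)
  have hBm : MeasurableSet B := measurableSet_ball
  have hBm' : MeasurableSet B' := measurableSet_ball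
  -- The potential is cut at the doubled ball. For `x ∈ B` and `y ∉ B'` one has `|x₀ - y| ≤ 2 |x -
  -- y|`, so the far part is at most twice its value at the centre `x₀`.
  have split : ∀ᵐ x, x ∈ B → v x ≤ (G + 2 * c * F)
      + c * ∫⁻ y, B'.indicator (fun y => a y * v y) y * (edist x y)⁻¹ := by
    filter_upwards [hsub] with x hx hxB
    refine hx.trans ?_
    rw [← lintegral_add_compl _ hBm', mul_add, add_assoc, add_comm (2 * (c : ℝ≥0∞) * F)]
    refine add_le_add_right (add_le_add ?_ ?_) _
    · refine mul_le_mul_right (le_of_eq ?_) _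
      rw [← lintegral_indicator hBm']
      refine lintegral_congr fun y => ?_
      rw [Set.indicator_mul_left]
    · rw [mul_comm 2, mul_assoc]
      refine mul_le_mul_right ?_ _
      rw [hF, ← lintegral_const_mul' _ _ (by norm_num)]
      refine setLIntegral_mono' hBm'.compl fun y hy => ?_
      have h1 : edist x₀ y ≤ 2 * edist x y := by
        have h2 : dist x x₀ < r := hxB
        have h3 : 2 * r ≤ dist y x₀ := by simpa [B'] using hy
        have h4 : dist x₀ y ≤ 2 * dist x y := by
          have := dist_triangle y x x₀
          rw [dist_comm y x] at this
          rw [dist_comm x₀ y]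
          linarith
        have h5 := ENNReal.ofReal_le_ofReal h4
        rwa [ENNReal.ofReal_mul (by norm_num), ENNReal.ofReal_ofNat, ← edist_dist,
          ← edist_dist] at h5
      calc a y * v y * (edist x y)⁻¹ = a y * v y * (2 * (2 * edist x y)⁻¹) := by
            rw [ENNReal.mul_inv (by simp) (by simp), ← mul_assoc 2,
              ENNReal.mul_inv_cancel (by simp) (by simp), one_mul]
        _ ≤ a y * v y * (2 * (edist x₀ y)⁻¹) := by gcongr
        _ = _ := by ring
  -- Hardy-Littlewood-Sobolev for `v³` on `B` and `a v` on `B'`. Their `L^(4/3)` norms are `V³` and,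
  -- by Hölder with exponents `2` and `4`, at most `e W`.
  have hls : ∫⁻ x, B.indicator (fun x => v x ^ (3 : ℝ)) x *
      ∫⁻ y, B'.indicator (fun y => a y * v y) y * (edist x y)⁻¹
        ≤ C * V ^ (3 : ℝ) * (e * W) := by
    have h := hC (B.indicator fun x => v x ^ (3 : ℝ)) (B'.indicator fun y => a y * v y)
      (V.toNNReal ^ (3 : ℝ)) (e * W.toNNReal) ((hv.pow_const _).indicator hBm)
      ((ha.mul hv).indicator hBm') ?_ ?_ ?_ ?_
    · rwa [ENNReal.coe_mul, ENNReal.coe_toNNReal hWt, ENNReal.coe_rpow_of_nonneg _ (by norm_num),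
        ENNReal.coe_toNNReal hVt] at h
    · refine (NNReal.rpow_pos ?_).ne'
      exact ENNReal.toNNReal_pos hV0 hVt
    · exact mul_ne_zero he (ENNReal.toNNReal_pos hW0 hWt).ne'
    · rw [ENNReal.coe_rpow_of_nonneg V.toNNReal (by norm_num), ENNReal.coe_toNNReal hVt,
        ← ENNReal.rpow_mul, show (3 * (4 / 3) : ℝ) = 4 by norm_num, hV, ballLFour_rpow_four,
        ← lintegral_indicator hBm]
      refine lintegral_mono fun x => ?_
      by_cases hx : x ∈ B
      · simp only [Set.indicator_of_mem hx, ← ENNReal.rpow_mul]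
        norm_num
      · simp [Set.indicator_of_notMem hx]
    · have h := ENNReal.lintegral_Lp_mul_le_Lq_mul_Lr (p := 4 / 3) (q := 2) (r := 4)
        (by norm_num) (by norm_num) (by norm_num) (volume.restrict B')
        ha.aemeasurable hv.aemeasurable
      have h2 : (∫⁻ y in B', a y ^ (2 : ℝ)) ^ (1 / 2 : ℝ) ≤ e := by
        have := ENNReal.rpow_le_rpow ((setLIntegral_le_lintegral B' _).trans hae)
          (show (0 : ℝ) ≤ 1 / 2 by norm_num)
        rw [← ENNReal.rpow_mul] at this
        norm_num at this
        simpa using this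
      have h3 := ENNReal.rpow_le_rpow (h.trans (mul_le_mul_left h2 _))
        (show (0 : ℝ) ≤ 4 / 3 by norm_num)
      rw [← ENNReal.rpow_mul] at h3
      rw [ENNReal.coe_mul, ENNReal.coe_toNNReal hWt]
      refine le_trans (le_of_eq ?_) h3
      norm_num
      rw [← lintegral_indicator hBm']
      refine lintegral_congr fun x => ?_
      by_cases hx : x ∈ B'
      · simp only [Set.indicator_of_mem hx]
      · simp [Set.indicator_of_notMem hx]
  have main : V ^ (3 : ℝ) * V ≤ V ^ (3 : ℝ) * (2 * ENNReal.ofReal (r ^ (1 / 2 : ℝ)) *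
      (G + 2 * c * F) + c * C * e * W) := by
    calc V ^ (3 : ℝ) * V = V ^ (4 : ℝ) := by
          nth_rewrite 2 [← ENNReal.rpow_one V]
          rw [← ENNReal.rpow_add _ _ hV0 hVt]
          norm_num
      _ = ∫⁻ x in B, v x ^ (4 : ℝ) := ballLFour_rpow_four _ _ _
      _ = ∫⁻ x in B, v x ^ (3 : ℝ) * v x := by
          refine lintegral_congr fun x => ?_
          rw [show (4 : ℝ) = 3 + 1 by norm_num, ENNReal.rpow_add_of_nonneg _ _ (by norm_num)
            (by norm_num), ENNReal.rpow_one]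
      _ ≤ ∫⁻ x in B, ((G + 2 * c * F) * v x ^ (3 : ℝ) + c * (v x ^ (3 : ℝ) *
            ∫⁻ y, B'.indicator (fun y => a y * v y) y * (edist x y)⁻¹)) := by
          refine lintegral_mono_ae ?_
          rw [ae_restrict_iff' hBm]
          filter_upwards [split] with x hx hxB
          calc _ ≤ v x ^ (3 : ℝ) * _ := mul_le_mul_right (hx hxB) _
            _ = _ := by ring
      _ = (G + 2 * c * F) * (∫⁻ x in B, v x ^ (3 : ℝ)) + c * ∫⁻ x in B, (v x ^ (3 : ℝ) *
            ∫⁻ y, B'.indicator (fun y => a y * v y) y * (edist x y)⁻¹) := by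
          rw [lintegral_add_left (by fun_prop), lintegral_const_mul _ (by fun_prop),
            lintegral_const_mul' _ _ ENNReal.coe_ne_top]
      _ ≤ (G + 2 * c * F) * (V ^ (3 : ℝ) * (2 * ENNReal.ofReal (r ^ (1 / 2 : ℝ))))
            + c * (C * V ^ (3 : ℝ) * (e * W)) := by
          gcongr
          · exact setLIntegral_rpow_three_le hv x₀ hr
          · refine le_trans (le_of_eq ?_) hls
            rw [← lintegral_indicator hBm]
            refine lintegral_congr fun x => ?_
            rw [Set.indicator_mul_left]
      _ = _ := by ring
  have hV3 : V ^ (3 : ℝ) ≠ 0 := by simp [hV0]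
  have hV3t : V ^ (3 : ℝ) ≠ ⊤ := ENNReal.rpow_ne_top_of_nonneg (by norm_num) hVt
  exact (ENNReal.mul_le_mul_iff_right hV3 hV3t).1 main

/-- Hölder with exponents `2, 4, 4`. The norm of `a` is kept on `S` alone, so that on a dyadic
annulus only the share of `a` on that annulus appears. -/
theorem setLIntegral_mul_le_ballLFour {v a : Plane → ℝ≥0∞} (hv : Measurable v)
    (ha : Measurable a) {S : Set Plane} {x : Plane} {r : ℝ} (hr : 0 < r)
    (hS : S ⊆ Metric.ball x r) :
    ∫⁻ y in S, a y * v y ≤ (∫⁻ y in S, a y ^ (2 : ℝ)) ^ (1 / 2 : ℝ) *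
      (ballLFour v x r * (2 * ENNReal.ofReal (r ^ (1 / 2 : ℝ)))) := by
  refine (ENNReal.lintegral_mul_le_Lp_mul_Lq (volume.restrict S) Real.HolderConjugate.two_two
    ha.aemeasurable hv.aemeasurable).trans ?_
  refine mul_le_mul_right ?_ _
  have h := ENNReal.lintegral_Lp_mul_le_Lq_mul_Lr (p := 2) (q := 4) (r := 4) (by norm_num)
    (by norm_num) (by norm_num) (volume.restrict S) hv.aemeasurable
    (aemeasurable_const (b := (1 : ℝ≥0∞)))
  simp only [Pi.mul_apply, mul_one, ENNReal.one_rpow, lintegral_const, one_mul,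
    Measure.restrict_apply_univ] at h
  refine h.trans (mul_le_mul' ?_ ?_)
  · exact ENNReal.rpow_le_rpow (lintegral_mono_set hS) (by norm_num)
  · refine (ENNReal.rpow_le_rpow ((measure_mono hS).trans (Plane.volume_ball_le x hr.le))
      (by norm_num)).trans ?_
    rw [ENNReal.mul_rpow_of_nonneg _ _ (by norm_num), ENNReal.ofReal_rpow_of_pos (by positivity),
      ← Real.rpow_natCast, ← Real.rpow_mul hr.le]
    refine mul_le_mul' ?_ (le_of_eq (by norm_num))
    calc (4 : ℝ≥0∞) ^ (1 / 4 : ℝ) ≤ 4 ^ (1 / 2 : ℝ) :=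
          ENNReal.rpow_le_rpow_of_exponent_le (by norm_num) (by norm_num)
      _ = 2 := by
        rw [show (4 : ℝ≥0∞) = 2 ^ (2 : ℝ) by norm_num, ← ENNReal.rpow_mul]
        norm_num

/-! ### Discrete Gronwall and growth along dyadic radii -/

/-- The products `W k` solve `W k = 1 + K ∑ α j W j` exactly. By induction the right side of the
recursion is at most `M W k + 2 M W k = 3 M W k`, which the factor `4` on the left absorbs. -/
theorem le_mul_prod_of_discrete_gronwall {Y α : ℕ → ℝ≥0∞} {A K M : ℝ≥0∞} (hA : A ≤ M)
    (h0 : Y 0 ≤ M)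
    (hY : ∀ k, 4 * Y (k + 1) ≤ A + K * ∑ j ∈ Finset.range k, α j * Y j + 2 * Y k) (k : ℕ) :
    Y k ≤ M * ∏ j ∈ Finset.range k, (1 + K * α j) := by
  set W : ℕ → ℝ≥0∞ := fun k => ∏ j ∈ Finset.range k, (1 + K * α j) with hW_def
  have hsum : ∀ k, W k = 1 + K * ∑ j ∈ Finset.range k, α j * W j := by
    intro k
    induction k with
    | zero => simp [hW_def]
    | succ k ih =>
      have h1 : W (k + 1) = W k * (1 + K * α k) := Finset.prod_range_succ _ _
      rw [h1, Finset.sum_range_succ, mul_add K, ← add_assoc, ← ih]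
      ring
  induction k using Nat.strong_induction_on with
  | _ k ih =>
    rcases k with _ | k
    · simpa using h0
    have hk := ih k (Nat.lt_succ_self k)
    have h1 : 4 * Y (k + 1) ≤ 4 * (M * W k) := by
      calc 4 * Y (k + 1) ≤ A + K * ∑ j ∈ Finset.range k, α j * Y j + 2 * Y k := hY k
        _ ≤ M + K * ∑ j ∈ Finset.range k, α j * (M * W j) + 2 * (M * W k) := by
            gcongr with j hj
            exact ih j (by have := Finset.mem_range.1 hj; omega)
        _ = M * (1 + K * ∑ j ∈ Finset.range k, α j * W j) + 2 * (M * W k) := by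
            have : ∑ j ∈ Finset.range k, α j * (M * W j)
                = M * ∑ j ∈ Finset.range k, α j * W j := by
              rw [Finset.mul_sum]
              exact Finset.sum_congr rfl fun j _ => by ring
            rw [this]
            ring
        _ = 3 * (M * W k) := by rw [← hsum]; ring
        _ ≤ 4 * (M * W k) := by gcongr; norm_num
    have h2 : Y (k + 1) ≤ M * W k :=
      (ENNReal.mul_le_mul_iff_right (by norm_num) (by norm_num)).1 h1
    refine h2.trans (mul_le_mul_right ?_ _)
    have h3 : W (k + 1) = W k * (1 + K * α k) := Finset.prod_range_succ _ _
    change W k ≤ W (k + 1)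
    rw [h3]
    exact le_mul_of_one_le_right' le_self_add

/-- Use `1 + t ≤ exp t` and Cauchy-Schwarz on the sum of the `α j`. Square summability gives `√k` in
place of `k`, hence subexponential growth whatever the size of `e`. -/
theorem prod_one_add_mul_le_exp {α : ℕ → ℝ≥0} {e K : ℝ≥0} {k : ℕ}
    (hα : ∑ j ∈ Finset.range k, α j ^ 2 ≤ e ^ 2) :
    ∏ j ∈ Finset.range k, (1 + (K : ℝ) * α j) ≤ Real.exp (K * e * √k) := by
  have h1 : ∑ j ∈ Finset.range k, (α j : ℝ) ≤ e * √k := by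
    have hcs := sq_sum_le_card_mul_sum_sq (s := Finset.range k) (f := fun j => (α j : ℝ))
    have hα' : ∑ j ∈ Finset.range k, (α j : ℝ) ^ 2 ≤ (e : ℝ) ^ 2 := by exact_mod_cast hα
    refine abs_le_of_sq_le_sq' ?_ (by positivity) |>.2
    rw [mul_pow, Real.sq_sqrt (by positivity), mul_comm]
    refine hcs.trans ?_
    rw [Finset.card_range]
    gcongr
  calc ∏ j ∈ Finset.range k, (1 + (K : ℝ) * α j)
      ≤ ∏ j ∈ Finset.range k, Real.exp (K * α j) := by
        refine Finset.prod_le_prod (fun j _ => by positivity) fun j _ => ?_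
        rw [add_comm]
        exact Real.add_one_le_exp _
    _ = Real.exp (K * ∑ j ∈ Finset.range k, (α j : ℝ)) := by
        rw [← Real.exp_sum, Finset.mul_sum]
    _ ≤ _ := by
        rw [mul_assoc]
        gcongr

/-- Growth of the scale-invariant local `L⁴` norms of a subsolution along dyadic radii. -/
theorem ballLFour_dyadic_le :
    ∃ C : ℝ≥0, ∀ (v a : Plane → ℝ≥0∞) (G c e N : ℝ≥0), Measurable v → Measurable a →
      ∫⁻ y, v y ^ (4 : ℝ) ≤ (N : ℝ≥0∞) ^ (4 : ℝ) → ∫⁻ y, a y ^ (2 : ℝ) ≤ (e : ℝ≥0∞) ^ (2 : ℝ) →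
      e ≠ 0 → 4 * c * C * e ≤ 1 → (∀ y ∉ Disc 1, v y = 0) →
      (∀ᵐ x, v x ≤ G + c * ∫⁻ y, a y * v y * (edist x y)⁻¹) →
      ∀ (x₀ : Plane) (k : ℕ), ballLFour v x₀ ((1 / 2) ^ k) * ENNReal.ofReal (√2 ^ k)
        ≤ (8 * G + 32 * c * e * N + N : ℝ≥0) * ENNReal.ofReal (Real.exp (64 * c * e * √k)) := by
  obtain ⟨C, hC⟩ := ballLFour_le_of_le_potential
  refine ⟨C, fun v a G c e N hv ha hvN hae he hsmall hsupp hsub x₀ => ?_⟩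
  set B : ℕ → Set Plane := fun k => Metric.ball x₀ ((1 / 2) ^ k) with hB
  have hBm : ∀ k, MeasurableSet (B k) := fun k => measurableSet_ball
  have hanti : ∀ {i j}, i ≤ j → B j ⊆ B i := fun h =>
    Metric.ball_subset_ball (pow_le_pow_of_le_one (by norm_num) (by norm_num) h)
  -- The weight `√2 ^ k` is `r^(-1/2)` at `r = 2⁻ᵏ`. It cancels the factor `r^(1/2)` on the constant
  -- terms.
  set Y : ℕ → ℝ≥0∞ := fun k => ballLFour v x₀ ((1 / 2) ^ k) * ENNReal.ofReal (√2 ^ k) with hY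
  set α : ℕ → ℝ≥0∞ := fun k => (∫⁻ y in B k \ B (k + 1), a y ^ (2 : ℝ)) ^ (1 / 2 : ℝ) with hα
  set F : ℕ → ℝ≥0∞ := fun k => ∫⁻ y in (B k)ᶜ, a y * v y * (edist x₀ y)⁻¹ with hF
  have hrad : ∀ k : ℕ, ((1 / 2 : ℝ) ^ k) ^ (1 / 2 : ℝ) = (√2 ^ k)⁻¹ := by
    intro k
    rw [← Real.sqrt_eq_rpow, one_div, inv_pow, Real.sqrt_inv]
    congr 1
    rw [Real.sqrt_eq_iff_mul_self_eq (by positivity) (by positivity), ← mul_pow,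
      Real.mul_self_sqrt (by norm_num)]
  have hw : ∀ k : ℕ, ENNReal.ofReal ((√2 ^ k)⁻¹) * ENNReal.ofReal (√2 ^ k) = 1 := by
    intro k
    rw [← ENNReal.ofReal_mul (by positivity), inv_mul_cancel₀ (by positivity), ENNReal.ofReal_one]
  have hF0 : F 0 ≤ 2 * e * N := by
    calc F 0 ≤ ∫⁻ y in (B 0)ᶜ, a y * v y := by
          refine setLIntegral_mono' (hBm 0).compl fun y hy => ?_
          have h1 : 1 ≤ edist x₀ y := by
            have h2 : 1 ≤ dist x₀ y := by simpa [hB, dist_comm] using hy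
            rw [edist_dist]
            simpa using h2
          calc _ ≤ a y * v y * 1 := by
                gcongr
                exact ENNReal.inv_le_one.2 h1
            _ = _ := mul_one _
      _ ≤ ∫⁻ y, a y * v y := setLIntegral_le_lintegral _ _
      _ = ∫⁻ y in Disc 1, a y * v y := by
          rw [← lintegral_indicator measurableSet_ball]
          refine lintegral_congr fun y => ?_
          by_cases hy : y ∈ Disc 1
          · rw [Set.indicator_of_mem hy]
          · rw [Set.indicator_of_notMem hy, hsupp y hy, mul_zero]
      _ ≤ _ := setLIntegral_mul_le_ballLFour hv ha one_pos subset_rfl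
      _ ≤ e * (N * (2 * 1)) := by
          gcongr
          · have := ENNReal.rpow_le_rpow ((setLIntegral_le_lintegral (Disc 1) _).trans hae)
              (show (0 : ℝ) ≤ 1 / 2 by norm_num)
            rw [← ENNReal.rpow_mul] at this
            norm_num at this
            simpa using this
          · exact ballLFour_le_of_lintegral_le hvN _ _
          · simp
      _ = _ := by ring
  -- On the new annulus the kernel is at most `2^(k+1)`, while Hölder gives `2 · 2^(-k/2) α k` times
  -- the `L⁴` norm. The product is `4 α k Y k`.
  have hFs : ∀ k, F (k + 1) ≤ F k + 4 * (α k * Y k) := by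
    intro k
    have hun : (B (k + 1))ᶜ = (B k)ᶜ ∪ (B k \ B (k + 1)) := by
      ext y
      have := @hanti k (k + 1) (Nat.le_succ k) y
      simp only [Set.mem_compl_iff, Set.mem_union, Set.mem_sdiff]
      tauto
    have hle : F (k + 1) ≤ F k + ∫⁻ y in B k \ B (k + 1), a y * v y * (edist x₀ y)⁻¹ := by
      simp only [hF]
      rw [hun]
      exact lintegral_union_le _ _ _
    refine hle.trans (add_le_add_right ?_ _)
    calc ∫⁻ y in B k \ B (k + 1), a y * v y * (edist x₀ y)⁻¹
        ≤ ∫⁻ y in B k \ B (k + 1), ENNReal.ofReal (2 ^ (k + 1)) * (a y * v y) := by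
          refine setLIntegral_mono' ((hBm k).diff (hBm (k + 1))) fun y hy => ?_
          rw [mul_comm]
          gcongr
          have h2 : (1 / 2) ^ (k + 1) ≤ dist x₀ y := by
            have := hy.2
            simpa only [hB, Metric.mem_ball, not_lt, dist_comm] using this
          rw [edist_dist, ← ENNReal.ofReal_inv_of_pos (lt_of_lt_of_le (by positivity) h2)]
          refine ENNReal.ofReal_le_ofReal ?_
          rw [inv_le_comm₀ (lt_of_lt_of_le (by positivity) h2) (by positivity)]
          simpa using h2
      _ = ENNReal.ofReal (2 ^ (k + 1)) * ∫⁻ y in B k \ B (k + 1), a y * v y :=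
          lintegral_const_mul' _ _ ENNReal.ofReal_ne_top
      _ ≤ ENNReal.ofReal (2 ^ (k + 1)) * (α k * (ballLFour v x₀ ((1 / 2) ^ k) *
            (2 * ENNReal.ofReal (((1 / 2 : ℝ) ^ k) ^ (1 / 2 : ℝ))))) := by
          gcongr
          exact setLIntegral_mul_le_ballLFour hv ha (by positivity) Set.sdiff_subset
      _ = α k * ballLFour v x₀ ((1 / 2) ^ k) * 2 *
            (ENNReal.ofReal (2 ^ (k + 1)) * ENNReal.ofReal ((√2 ^ k)⁻¹)) := by
          rw [hrad]; ring
      _ = α k * ballLFour v x₀ ((1 / 2) ^ k) * 2 * (2 * ENNReal.ofReal (√2 ^ k)) := by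
          congr 1
          rw [← ENNReal.ofReal_mul (by positivity), ← ENNReal.ofReal_ofNat 2,
            ← ENNReal.ofReal_mul (by positivity)]
          congr 1
          have h3 : (2 : ℝ) ^ k = √2 ^ k * √2 ^ k := by
            rw [← mul_pow, Real.mul_self_sqrt (by norm_num)]
          rw [pow_succ, h3]
          field_simp
      _ = _ := by simp only [hY]; ring
  have hFk : ∀ k, F k ≤ 2 * e * N + 4 * ∑ j ∈ Finset.range k, α j * Y j := by
    intro k
    induction k with
    | zero => simpa using hF0
    | succ k ih =>
      rw [Finset.sum_range_succ, mul_add, ← add_assoc]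
      exact (hFs k).trans (add_le_add_left ih _)
  have hrec : ∀ k, 4 * Y (k + 1) ≤ (8 * G + 32 * c * e * N : ℝ≥0)
      + (64 * c : ℝ≥0) * ∑ j ∈ Finset.range k, α j * Y j + 2 * Y k := by
    intro k
    have h := hC v a G c e N hv ha hvN hae he hsub x₀ ((1 / 2) ^ (k + 1)) (by positivity)
    rw [hrad, show 2 * (1 / 2 : ℝ) ^ (k + 1) = (1 / 2) ^ k by rw [pow_succ]; ring] at h
    -- This is where smallness of `e` enters: the coefficient of `Y k` becomes at most `2`, strictly
    -- below the `4` on the left.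
    have hs : 4 * (c * C * e : ℝ≥0∞) * ENNReal.ofReal √2 ≤ 2 := by
      have h1 : 4 * (c * C * e : ℝ≥0∞) ≤ 1 := by
        have : ((4 * c * C * e : ℝ≥0) : ℝ≥0∞) ≤ 1 := by exact_mod_cast hsmall
        refine le_trans (le_of_eq ?_) this
        push_cast
        ring
      have h2 : ENNReal.ofReal √2 ≤ 2 := by
        rw [← ENNReal.ofReal_ofNat 2]
        refine ENNReal.ofReal_le_ofReal ?_
        rw [Real.sqrt_le_left (by norm_num)]
        norm_num
      calc _ ≤ (1 : ℝ≥0∞) * 2 := mul_le_mul' h1 h2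
        _ = 2 := one_mul _
    calc 4 * Y (k + 1)
        ≤ 4 * ((2 * ENNReal.ofReal ((√2 ^ (k + 1))⁻¹) * (G + 2 * c * F k)
            + c * C * e * ballLFour v x₀ ((1 / 2) ^ k)) * ENNReal.ofReal (√2 ^ (k + 1))) := by
          simp only [hY]
          gcongr
      _ = 8 * (G + 2 * c * F k) * (ENNReal.ofReal ((√2 ^ (k + 1))⁻¹)
              * ENNReal.ofReal (√2 ^ (k + 1)))
            + (4 * (c * C * e) * ENNReal.ofReal √2) * Y k := by
          simp only [hY]
          rw [pow_succ (√2) k, ENNReal.ofReal_mul (p := √2 ^ k) (by positivity)]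
          ring
      _ ≤ 8 * (G + 2 * c * (2 * e * N + 4 * ∑ j ∈ Finset.range k, α j * Y j)) * 1
            + 2 * Y k := by
          rw [hw]
          gcongr
          exact hFk k
      _ = _ := by
          push_cast
          ring
  intro k
  have hαfin : ∀ j, α j ≠ ⊤ := by
    intro j
    refine ENNReal.rpow_ne_top_of_nonneg (by norm_num) (ne_top_of_le_ne_top ?_
      ((setLIntegral_le_lintegral _ _).trans hae))
    exact ENNReal.rpow_ne_top_of_nonneg (by norm_num) ENNReal.coe_ne_top
  have hαsum : ∑ j ∈ Finset.range k, (α j).toNNReal ^ 2 ≤ e ^ 2 := by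
    -- The integral over the remaining ball is carried along, so that removing one annulus at a time
    -- telescopes.
    have hind : ∀ k, ∑ j ∈ Finset.range k, α j ^ 2
        + ∫⁻ y in B k, a y ^ (2 : ℝ) ≤ ∫⁻ y, a y ^ (2 : ℝ) := by
      intro k
      induction k with
      | zero => simpa using setLIntegral_le_lintegral _ _
      | succ k ih =>
        refine le_trans (le_of_eq ?_) ih
        rw [Finset.sum_range_succ, add_assoc]
        congr 1
        rw [← lintegral_inter_add_sdiff (μ := volume) _ (B k) (hBm (k + 1)),
          Set.inter_eq_self_of_subset_right (hanti (Nat.le_succ k)), add_comm]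
        congr 1
        rw [← ENNReal.rpow_natCast, ← ENNReal.rpow_mul]
        norm_num
    have h1 := (le_self_add.trans (hind k)).trans hae
    rw [← ENNReal.coe_le_coe]
    push_cast
    simp_rw [ENNReal.coe_toNNReal (hαfin _)]
    exact_mod_cast h1
  have hg := le_mul_prod_of_discrete_gronwall (M := (8 * G + 32 * c * e * N + N : ℝ≥0))
    (K := (64 * c : ℝ≥0)) (A := (8 * G + 32 * c * e * N : ℝ≥0)) (Y := Y) (α := α)
    (ENNReal.coe_le_coe.2 le_self_add) ?_ hrec k
  · refine hg.trans (mul_le_mul_right ?_ _)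
    have h2 := prod_one_add_mul_le_exp (K := 64 * c) hαsum
    have h3 := ENNReal.ofReal_le_ofReal h2
    refine le_trans (le_of_eq ?_) (h3.trans (le_of_eq (by push_cast; rfl)))
    rw [ENNReal.ofReal_prod_of_nonneg (fun j _ => by positivity)]
    refine Finset.prod_congr rfl fun j _ => ?_
    rw [ENNReal.ofReal_add (by norm_num) (by positivity), ENNReal.ofReal_mul (by positivity),
      ENNReal.ofReal_coe_nnreal, ENNReal.ofReal_coe_nnreal, ENNReal.coe_toNNReal (hαfin j),
      ENNReal.ofReal_one]
  · simp only [hY, pow_zero, ENNReal.ofReal_one, mul_one]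
    refine (ballLFour_le_of_lintegral_le hvN _ _).trans ?_
    exact ENNReal.coe_le_coe.2 le_add_self

/-! ### From Morrey decay to `L^p` bounds -/

/-- Completing the square, `L √k ≤ L² / (4t) + t k` with `t = τ log 2`. Every positive rate `τ` is
allowed, and only the constant depends on it. -/
theorem exists_exp_mul_sqrt_le (L : ℝ) {τ : ℝ} (hτ : 0 < τ) :
    ∃ C : ℝ≥0, ∀ k : ℕ, Real.exp (L * √k) ≤ C * (2 : ℝ) ^ (τ * k) := by
  have hl : 0 < τ * Real.log 2 := mul_pos hτ (Real.log_pos (by norm_num))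
  set t := τ * Real.log 2
  refine ⟨(Real.exp (L ^ 2 / (4 * t))).toNNReal, fun k => ?_⟩
  rw [Real.coe_toNNReal _ (Real.exp_pos _).le, Real.rpow_def_of_pos (by norm_num), ← Real.exp_add]
  refine Real.exp_le_exp.2 ?_
  have h1 : Real.log 2 * (τ * k) = t * √k ^ 2 := by
    rw [Real.sq_sqrt (by positivity)]
    ring
  have h2 : L ^ 2 / (4 * t) + t * √k ^ 2 - L * √k = (L - 2 * t * √k) ^ 2 / (4 * t) := by
    field_simp
    ring
  have h3 : 0 ≤ (L - 2 * t * √k) ^ 2 / (4 * t) := by positivity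
  rw [h1]
  linarith

/-- On the layer `2^(-k-1) ≤ |x - y| < 2^(-k)` the kernel is at most `2^(β (k+1))` and the mass at
most `D 2^(-γ k)`. The layers sum to a geometric series of ratio `2^(β-γ) < 1`; beyond distance one
the kernel is at most `1`. -/
theorem lintegral_mul_edist_rpow_le_of_dyadic {β γ : ℝ} (hβ : 0 < β) (hγ : β < γ) :
    ∃ C : ℝ≥0, ∀ (f : Plane → ℝ≥0∞) (D : ℝ≥0∞) (x : Plane), Measurable f → ∫⁻ y, f y ≤ D →
      (∀ k : ℕ, ∫⁻ y in Metric.ball x ((1 / 2) ^ k), f y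
        ≤ D * ENNReal.ofReal ((2 : ℝ) ^ (-(γ * k)))) →
      ∫⁻ y, f y * edist x y ^ (-β) ≤ C * D := by
  set q : ℝ := 2 ^ (β - γ) with hq
  have hq0 : 0 < q := by positivity
  have hq1 : q < 1 := Real.rpow_lt_one_of_one_lt_of_neg (by norm_num) (by linarith)
  set S : ℝ≥0∞ := ∑' k : ℕ, ENNReal.ofReal (2 ^ β) * ENNReal.ofReal q ^ k with hS
  have hSt : S ≠ ⊤ := by
    rw [hS, ENNReal.tsum_mul_left, ENNReal.tsum_geometric]
    refine ENNReal.mul_ne_top ENNReal.ofReal_ne_top (ENNReal.inv_ne_top.2 ?_)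
    rw [← ENNReal.ofReal_one, ← ENNReal.ofReal_sub _ hq0.le]
    simpa using hq1
  refine ⟨1 + S.toNNReal, fun f D x hf hfD hk => ?_⟩
  have hpt : ∀ᵐ y, f y * edist x y ^ (-β) ≤ f y + ∑' k : ℕ,
      (Metric.ball x ((1 / 2) ^ k)).indicator
        (fun y => ENNReal.ofReal (2 ^ (β * (k + 1))) * f y) y := by
    have h0 : ∀ᵐ y : Plane, y ≠ x := by simp [ae_iff]
    filter_upwards [h0] with y hy
    have hd : 0 < dist x y := dist_pos.2 hy.symm
    rcases le_or_gt 1 (dist x y) with h1 | h1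
    · refine le_add_right ?_
      calc f y * edist x y ^ (-β) ≤ f y * 1 := by
            refine mul_le_mul_right (ENNReal.rpow_le_one_of_one_le_of_neg ?_ ?_) _
            · rw [edist_dist]
              simpa using h1
            · linarith
        _ = f y := mul_one _
    · refine le_add_left ?_
      have hex : ∃ n : ℕ, (1 / 2 : ℝ) ^ (n + 1) ≤ dist x y := by
        obtain ⟨n, hn⟩ := exists_pow_lt_of_lt_one hd (show (1 / 2 : ℝ) < 1 by norm_num)
        exact ⟨n, (pow_le_pow_of_le_one (by norm_num) (by norm_num) n.le_succ).trans hn.le⟩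
      classical
      obtain ⟨k, hk1, hk2⟩ : ∃ k : ℕ, (1 / 2 : ℝ) ^ (k + 1) ≤ dist x y ∧
          dist x y < (1 / 2) ^ k := by
        refine ⟨Nat.find hex, Nat.find_spec hex, ?_⟩
        rcases hn : Nat.find hex with _ | n
        · simpa using h1
        · exact not_le.1 (Nat.find_min hex (by omega))
      refine le_trans ?_ (ENNReal.le_tsum k)
      rw [Set.indicator_of_mem (by rwa [Metric.mem_ball, dist_comm]), mul_comm]
      gcongr
      rw [edist_dist, ENNReal.ofReal_rpow_of_pos hd]
      refine ENNReal.ofReal_le_ofReal ?_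
      refine (Real.rpow_le_rpow_of_nonpos (by positivity) hk1 (by linarith)).trans (le_of_eq ?_)
      rw [one_div, ← Real.rpow_natCast, Real.inv_rpow (by norm_num), ← Real.rpow_neg (by norm_num),
        ← Real.rpow_mul (by norm_num)]
      push_cast
      ring_nf
  calc ∫⁻ y, f y * edist x y ^ (-β)
      ≤ ∫⁻ y, (f y + ∑' k : ℕ, (Metric.ball x ((1 / 2) ^ k)).indicator
        (fun y => ENNReal.ofReal (2 ^ (β * (k + 1))) * f y) y) := lintegral_mono_ae hpt
    _ = (∫⁻ y, f y) + ∑' k : ℕ, ENNReal.ofReal (2 ^ (β * (k + 1))) *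
          ∫⁻ y in Metric.ball x ((1 / 2) ^ k), f y := by
        rw [lintegral_add_left hf, lintegral_tsum fun k =>
          ((hf.const_mul _).indicator measurableSet_ball).aemeasurable]
        congr 2 with k
        rw [lintegral_indicator measurableSet_ball, lintegral_const_mul _ hf]
    _ ≤ D + ∑' k : ℕ, ENNReal.ofReal (2 ^ (β * (k + 1))) *
          (D * ENNReal.ofReal ((2 : ℝ) ^ (-(γ * k)))) := by
        gcongr with k
        exact hk k
    _ = D + S * D := by
        rw [hS, ← ENNReal.tsum_mul_right]
        congr 2 with k
        rw [← ENNReal.ofReal_pow hq0.le, ← ENNReal.ofReal_mul (by positivity), mul_left_comm,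
          mul_comm D, ← ENNReal.ofReal_mul (by positivity), hq, ← Real.rpow_natCast,
          ← Real.rpow_mul (by norm_num), ← Real.rpow_add (by norm_num),
          ← Real.rpow_add (by norm_num)]
        ring_nf
    _ = _ := by
        rw [ENNReal.coe_add, ENNReal.coe_toNNReal hSt, ENNReal.coe_one]
        ring

theorem lintegral_disc_edist_rpow_le {s : ℝ} (hs : 0 < s) (hs2 : s < 2) :
    ∃ C : ℝ≥0, ∀ x : Plane, ∫⁻ y in Disc 1, edist x y ^ (-s) ≤ C := by
  obtain ⟨C, hC⟩ := Plane.lintegral_ball_edist_rpow_le hs.le hs2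
  refine ⟨C + 4, fun x => ?_⟩
  have hm : Measurable fun y : Plane => edist x y ^ (-s) := by fun_prop
  calc ∫⁻ y in Disc 1, edist x y ^ (-s)
      ≤ ∫⁻ y in Disc 1, ((Metric.ball x 1).indicator (fun y => edist x y ^ (-s)) y + 1) := by
        refine lintegral_mono fun y => ?_
        by_cases hy : y ∈ Metric.ball x 1
        · rw [Set.indicator_of_mem hy]
          exact le_self_add
        · refine le_add_left (ENNReal.rpow_le_one_of_one_le_of_neg ?_ (by linarith))
          rw [edist_dist]
          simpa [dist_comm] using hy
    _ = (∫⁻ y in Disc 1, (Metric.ball x 1).indicator (fun y => edist x y ^ (-s)) y)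
          + volume (Disc 1) := by
        rw [lintegral_add_right _ measurable_const]
        simp
    _ ≤ C + 4 := by
        refine add_le_add ?_ ?_
        · refine (setLIntegral_le_lintegral _ _).trans ?_
          rw [lintegral_indicator measurableSet_ball]
          simpa using hC x 1 one_pos
        · simpa using Plane.volume_ball_le 0 zero_le_one
    _ = _ := by push_cast; rfl

/-- `L^p` bounds for the potential of a function with small mass on balls. -/
theorem lintegral_disc_potential_rpow_le {p τ : ℝ} (hp : 4 < p) (hτ : τ < 1 / (2 * (p - 1))) :
    ∃ C : ℝ≥0, ∀ (f : Plane → ℝ≥0∞) (D : ℝ≥0), Measurable f → ∫⁻ y, f y ≤ D →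
      (∀ (x : Plane) (k : ℕ), ∫⁻ y in Metric.ball x ((1 / 2) ^ k), f y
        ≤ D * ENNReal.ofReal ((2 : ℝ) ^ (-((1 - τ) * k)))) →
      ∫⁻ x in Disc 1, (∫⁻ y, f y * (edist x y)⁻¹) ^ p ≤ C * (D : ℝ≥0∞) ^ p := by
  have hp1 : 0 < p - 1 := by linarith
  -- Chosen so that `(3/2) / p + β (p - 1) / p = 1`, which splits `|x - y|⁻¹` for Hölder. Since `β =
  -- 1 - 1 / (2 (p - 1))`, the hypothesis on `τ` says exactly that `β < 1 - τ`.
  set β := (p - 3 / 2) / (p - 1) with hβ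
  have hβ0 : 0 < β := div_pos (by linarith) hp1
  have hβ1 : β < 1 - τ := by
    have : β = 1 - 1 / (2 * (p - 1)) := by
      rw [hβ]
      field_simp
      ring
    linarith
  obtain ⟨C₁, h₁⟩ := lintegral_mul_edist_rpow_le_of_dyadic hβ0 hβ1
  obtain ⟨C₂, h₂⟩ := lintegral_disc_edist_rpow_le (s := 3 / 2) (by norm_num) (by norm_num)
  refine ⟨C₁ ^ (p - 1) * C₂, fun f D hf hfD hk => ?_⟩
  -- Hölder with respect to the measure `f dy`. The factor with exponent `β` is bounded uniformly in
  -- `x` by the Morrey decay; the one with exponent `3/2 < 2` will be integrated in `x` over the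
  -- disc after exchanging integrals.
  have hpt : ∀ x, (∫⁻ y, f y * (edist x y)⁻¹) ^ p
      ≤ (∫⁻ y, f y * edist x y ^ (-(3 / 2) : ℝ)) * (C₁ * D : ℝ≥0∞) ^ (p - 1) := by
    intro x
    have hpq : p.HolderConjugate (p / (p - 1)) := by
      rw [Real.holderConjugate_iff]
      refine ⟨by linarith, ?_⟩
      field_simp
      ring
    have hH := ENNReal.lintegral_mul_le_Lp_mul_Lq volume hpq
      (f := fun y => f y ^ (1 / p) * edist x y ^ (-(3 / 2) / p))
      (g := fun y => f y ^ ((p - 1) / p) * edist x y ^ (-β * ((p - 1) / p)))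
      (by fun_prop) (by fun_prop)
    have e1 : ∫⁻ y, f y * (edist x y)⁻¹
        = ∫⁻ y, ((fun y => f y ^ (1 / p) * edist x y ^ (-(3 / 2) / p)) *
            (fun y => f y ^ ((p - 1) / p) * edist x y ^ (-β * ((p - 1) / p)))) y := by
      refine lintegral_congr_ae ?_
      have h0 : ∀ᵐ y : Plane, y ≠ x := by simp [ae_iff]
      filter_upwards [h0] with y hy
      have hd : edist x y ≠ 0 := by simpa [edist_eq_zero] using hy.symm
      have a1 : f y ^ (1 / p) * f y ^ ((p - 1) / p) = f y := by
        rw [← ENNReal.rpow_add_of_nonneg _ _ (by positivity) (by positivity), ← add_div]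
        rw [show (1 + (p - 1)) / p = 1 by field_simp; ring, ENNReal.rpow_one]
      have a2 : edist x y ^ (-(3 / 2) / p) * edist x y ^ (-β * ((p - 1) / p))
          = (edist x y)⁻¹ := by
        rw [← ENNReal.rpow_add _ _ hd (edist_ne_top _ _), ← ENNReal.rpow_neg_one]
        congr 1
        rw [hβ]
        field_simp
        ring
      simp only [Pi.mul_apply]
      rw [mul_mul_mul_comm, a1, a2]
    have e2 : ∫⁻ y, (f y ^ (1 / p) * edist x y ^ (-(3 / 2) / p)) ^ p
        = ∫⁻ y, f y * edist x y ^ (-(3 / 2) : ℝ) := by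
      refine lintegral_congr fun y => ?_
      rw [ENNReal.mul_rpow_of_nonneg _ _ (by linarith), ← ENNReal.rpow_mul, ← ENNReal.rpow_mul,
        one_div_mul_cancel (by linarith), div_mul_cancel₀ _ (by linarith), ENNReal.rpow_one]
    have e3 : ∫⁻ y, (f y ^ ((p - 1) / p) * edist x y ^ (-β * ((p - 1) / p))) ^ (p / (p - 1))
        = ∫⁻ y, f y * edist x y ^ (-β) := by
      have hone : (p - 1) / p * (p / (p - 1)) = 1 := by field_simp
      refine lintegral_congr fun y => ?_
      rw [ENNReal.mul_rpow_of_nonneg _ _ (by positivity), ← ENNReal.rpow_mul, ← ENNReal.rpow_mul,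
        mul_assoc, hone, ENNReal.rpow_one, mul_one]
    rw [← e1, e2, e3] at hH
    refine (ENNReal.rpow_le_rpow hH (by linarith)).trans ?_
    rw [ENNReal.mul_rpow_of_nonneg _ _ (by linarith), ← ENNReal.rpow_mul, ← ENNReal.rpow_mul,
      one_div_mul_cancel (by linarith), ENNReal.rpow_one,
      show 1 / (p / (p - 1)) * p = p - 1 by field_simp]
    refine mul_le_mul_right (ENNReal.rpow_le_rpow ?_ hp1.le) _
    exact h₁ f D x hf hfD (hk x)
  calc ∫⁻ x in Disc 1, (∫⁻ y, f y * (edist x y)⁻¹) ^ p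
      ≤ ∫⁻ x in Disc 1, (∫⁻ y, f y * edist x y ^ (-(3 / 2) : ℝ)) * (C₁ * D : ℝ≥0∞) ^ (p - 1) :=
        lintegral_mono hpt
    _ = (∫⁻ x in Disc 1, ∫⁻ y, f y * edist x y ^ (-(3 / 2) : ℝ)) * (C₁ * D : ℝ≥0∞) ^ (p - 1) :=
        lintegral_mul_const' _ _ (ENNReal.rpow_ne_top_of_nonneg hp1.le
          (ENNReal.mul_ne_top ENNReal.coe_ne_top ENNReal.coe_ne_top))
    _ = (∫⁻ y, f y * ∫⁻ x in Disc 1, edist y x ^ (-(3 / 2) : ℝ)) * (C₁ * D : ℝ≥0∞) ^ (p - 1) := by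
        congr 1
        rw [lintegral_lintegral_swap (by fun_prop)]
        refine lintegral_congr fun y => ?_
        rw [lintegral_const_mul _ (by fun_prop)]
        simp_rw [edist_comm y]
    _ ≤ (D * C₂) * (C₁ * D : ℝ≥0∞) ^ (p - 1) := by
        gcongr
        calc _ ≤ ∫⁻ y, f y * C₂ := by
              gcongr with y
              exact h₂ y
          _ = (∫⁻ y, f y) * C₂ := lintegral_mul_const _ hf
          _ ≤ D * C₂ := by gcongr
    _ = _ := by
        have : (D : ℝ≥0∞) ^ p = (D : ℝ≥0∞) ^ (p - 1) * D := by
          nth_rewrite 3 [← ENNReal.rpow_one (D : ℝ≥0∞)]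
          rw [← ENNReal.rpow_add_of_nonneg _ _ hp1.le zero_le_one]
          norm_num
        rw [this, ENNReal.mul_rpow_of_nonneg _ _ hp1.le, ENNReal.coe_mul,
          ENNReal.coe_rpow_of_nonneg _ hp1.le]
        ring

/-- Higher integrability of subsolutions `v ≤ c N + c I₁(a v)` whose potential `a` is small in `L²`;
the smallness does not depend on the exponent. -/
theorem lintegral_disc_rpow_le_of_le_potential (c : ℝ≥0) :
    ∃ e : ℝ≥0, 0 < e ∧ ∀ p : ℝ, 4 < p → ∃ K : ℝ≥0, ∀ (v a : Plane → ℝ≥0∞) (N : ℝ≥0),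
      Measurable v → Measurable a → ∫⁻ y, v y ^ (4 : ℝ) ≤ (N : ℝ≥0∞) ^ (4 : ℝ) →
      ∫⁻ y, a y ^ (2 : ℝ) ≤ (e : ℝ≥0∞) ^ (2 : ℝ) → (∀ y ∉ Disc 1, v y = 0) →
      (∀ᵐ x, v x ≤ c * N + c * ∫⁻ y, a y * v y * (edist x y)⁻¹) →
      ∫⁻ x in Disc 1, v x ^ p ≤ (K * N : ℝ≥0∞) ^ p := by
  obtain ⟨C, hC⟩ := ballLFour_dyadic_le
  -- The threshold is fixed before `p`; it only has to ensure `4 c C e ≤ 1`, and the `+ 1` avoids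
  -- inverting zero.
  refine ⟨(4 * c * C + 1)⁻¹, by positivity, fun p hp => ?_⟩
  set e : ℝ≥0 := (4 * c * C + 1)⁻¹ with he_def
  have he : e ≠ 0 := by positivity
  have hsmall : 4 * c * C * e ≤ 1 := by
    rw [he_def, ← div_eq_mul_inv]
    exact div_le_one_of_le₀ le_self_add zero_le
  have hp1 : 0 < p - 1 := by linarith
  set τ : ℝ := 1 / (4 * (p - 1)) with hτ_def
  have hτ : 0 < τ := by positivity
  have hτ2 : τ < 1 / (2 * (p - 1)) := by
    rw [hτ_def]
    exact one_div_lt_one_div_of_lt (by positivity) (by linarith)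
  obtain ⟨C₁, h₁⟩ := lintegral_disc_potential_rpow_le hp hτ2
  obtain ⟨C₂, h₂⟩ := exists_exp_mul_sqrt_le (64 * c * e) hτ
  set M : ℝ≥0 := 8 * c + 32 * c * e + 1 with hM
  set D : ℝ≥0 := 2 * e * M * (C₂ + 1) with hD
  have hp0 : 0 ≤ p := by linarith
  refine ⟨(2 ^ (p - 1) * (c ^ p * 4 + c ^ p * (C₁ * D ^ p))) ^ (1 / p),
    fun v a N hv ha hvN hae hsupp hsub => ?_⟩
  -- By Hölder the mass of `a v` on the ball is at most `2 e Y k 2⁻ᵏ`, where `Y k` is the weighted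
  -- `L⁴` norm, and `Y k` grows at most like `2^(τ k)`.
  have hball : ∀ (x : Plane) (k : ℕ), ∫⁻ y in Metric.ball x ((1 / 2) ^ k), a y * v y
      ≤ (D * N : ℝ≥0) * ENNReal.ofReal ((2 : ℝ) ^ (-((1 - τ) * k))) := by
    intro x k
    have hY := hC v a (c * N) c e N hv ha hvN hae he hsmall hsupp (by simpa using hsub) x k
    have hrad : ((1 / 2 : ℝ) ^ k) ^ (1 / 2 : ℝ) = (√2 ^ k)⁻¹ := by
      rw [← Real.sqrt_eq_rpow, one_div, inv_pow, Real.sqrt_inv]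
      congr 1
      rw [Real.sqrt_eq_iff_mul_self_eq (by positivity) (by positivity), ← mul_pow,
        Real.mul_self_sqrt (by norm_num)]
    have h2k : (√2 ^ k)⁻¹ = √2 ^ k * ((2 : ℝ) ^ k)⁻¹ := by
      have h3 : (2 : ℝ) ^ k = √2 ^ k * √2 ^ k := by
        rw [← mul_pow, Real.mul_self_sqrt (by norm_num)]
      rw [h3]
      field_simp
    have ha2 : (∫⁻ y in Metric.ball x ((1 / 2) ^ k), a y ^ (2 : ℝ)) ^ (1 / 2 : ℝ) ≤ e := by
      have := ENNReal.rpow_le_rpow ((setLIntegral_le_lintegral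
        (Metric.ball x ((1 / 2) ^ k)) _).trans hae) (show (0 : ℝ) ≤ 1 / 2 by norm_num)
      rw [← ENNReal.rpow_mul] at this
      norm_num at this
      simpa using this
    calc ∫⁻ y in Metric.ball x ((1 / 2) ^ k), a y * v y
        ≤ e * (ballLFour v x ((1 / 2) ^ k) * (2 * ENNReal.ofReal ((√2 ^ k)⁻¹))) := by
          rw [← hrad]
          refine (setLIntegral_mul_le_ballLFour hv ha (by positivity) subset_rfl).trans ?_
          gcongr
      _ = 2 * e * (ballLFour v x ((1 / 2) ^ k) * ENNReal.ofReal (√2 ^ k))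
            * ENNReal.ofReal ((2 ^ k)⁻¹) := by
          rw [h2k, ENNReal.ofReal_mul (by positivity)]
          ring
      _ ≤ 2 * e * ((8 * (c * N) + 32 * c * e * N + N : ℝ≥0) *
            ENNReal.ofReal ((C₂ + 1 : ℝ≥0) * 2 ^ (τ * k))) * ENNReal.ofReal ((2 ^ k)⁻¹) := by
          refine mul_le_mul_left (mul_le_mul_right (hY.trans (mul_le_mul_right
            (ENNReal.ofReal_le_ofReal ((h₂ k).trans ?_)) _)) _) _
          gcongr
          exact le_self_add
      _ = _ := by
          rw [ENNReal.ofReal_mul (by positivity), ENNReal.ofReal_coe_nnreal]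
          rw [show -((1 - τ) * (k : ℝ)) = τ * k + -k by ring, Real.rpow_add (by norm_num),
            ENNReal.ofReal_mul (by positivity), Real.rpow_neg (by norm_num), Real.rpow_natCast,
            hD, hM]
          push_cast
          ring
  have htot : ∫⁻ y, a y * v y ≤ (D * N : ℝ≥0) := by
    calc ∫⁻ y, a y * v y = ∫⁻ y in Disc 1, a y * v y := by
          rw [← lintegral_indicator measurableSet_ball]
          refine lintegral_congr fun y => ?_
          by_cases hy : y ∈ Disc 1
          · rw [Set.indicator_of_mem hy]
          · rw [Set.indicator_of_notMem hy, hsupp y hy, mul_zero]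
      _ ≤ (D * N : ℝ≥0) := by simpa using hball 0 0
  have hpot := h₁ (fun y => a y * v y) (D * N) (ha.mul hv) htot hball
  calc ∫⁻ x in Disc 1, v x ^ p
      ≤ ∫⁻ x in Disc 1, 2 ^ (p - 1) * ((c * N : ℝ≥0∞) ^ p
          + (c : ℝ≥0∞) ^ p * (∫⁻ y, a y * v y * (edist x y)⁻¹) ^ p) := by
        refine lintegral_mono_ae (ae_restrict_of_ae ?_)
        filter_upwards [hsub] with x hx
        refine (ENNReal.rpow_le_rpow hx hp0).trans ?_
        refine (ENNReal.rpow_add_le_mul_rpow_add_rpow _ _ (by linarith)).trans ?_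
        rw [ENNReal.mul_rpow_of_nonneg _ (∫⁻ y, a y * v y * (edist x y)⁻¹) hp0]
    _ = 2 ^ (p - 1) * ((c * N : ℝ≥0∞) ^ p * volume (Disc 1) + (c : ℝ≥0∞) ^ p *
          ∫⁻ x in Disc 1, (∫⁻ y, a y * v y * (edist x y)⁻¹) ^ p) := by
        rw [lintegral_const_mul' _ _ (ENNReal.rpow_ne_top_of_nonneg hp1.le (by norm_num)),
          lintegral_add_left measurable_const, lintegral_const_mul' _ _
          (ENNReal.rpow_ne_top_of_nonneg hp0 ENNReal.coe_ne_top)]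
        simp
    _ ≤ 2 ^ (p - 1) * ((c * N : ℝ≥0∞) ^ p * 4 + (c : ℝ≥0∞) ^ p *
          (C₁ * ((D * N : ℝ≥0) : ℝ≥0∞) ^ p)) := by
        gcongr
        simpa using Plane.volume_ball_le 0 zero_le_one
    _ = _ := by
        rw [← ENNReal.coe_mul, ← ENNReal.coe_mul]
        have h2 : (2 : ℝ≥0∞) ^ (p - 1) = ((2 ^ (p - 1) : ℝ≥0) : ℝ≥0∞) := by
          rw [ENNReal.coe_rpow_of_nonneg _ hp1.le, ENNReal.coe_ofNat]
        rw [h2, ← ENNReal.coe_rpow_of_nonneg _ hp0, ← ENNReal.coe_rpow_of_nonneg _ hp0,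
          ← ENNReal.coe_rpow_of_nonneg _ hp0, ← ENNReal.coe_rpow_of_nonneg _ hp0,
          NNReal.mul_rpow (x := c) (y := N), NNReal.mul_rpow (x := D) (y := N),
          NNReal.mul_rpow (y := N), ← NNReal.rpow_mul,
          one_div_mul_cancel (by linarith), NNReal.rpow_one]
        push_cast
        ring

/-! ### A regularised fundamental solution of the Dirac operator -/

/-- Clifford multiplication as a continuous real-linear map. -/
noncomputable def cliffordCLM {q : ℕ} (α : Fin 2) : VectorSpinor q →L[ℝ] VectorSpinor q :=
  LinearMap.toContinuousLinearMap
    { toFun := cliffordMul α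
      map_add' := fun v w => by
        ext i
        simp [cliffordMul, mul_add]
        ring
      map_smul' := fun c v => by
        ext i
        simp [cliffordMul]
        ring }

theorem cliffordCLM_apply {q : ℕ} (α : Fin 2) (v : VectorSpinor q) :
    cliffordCLM α v = cliffordMul α v := rfl

theorem cliffordMul_cliffordMul_self {q : ℕ} (α : Fin 2) (v : VectorSpinor q) :
    cliffordCLM α (cliffordCLM α v) = -v := by
  ext ⟨b, i⟩
  fin_cases α <;> fin_cases b <;>
    simp [cliffordCLM_apply, cliffordMul, cliffordMatrix, ← mul_assoc]

theorem cliffordMul_one_cliffordMul_zero {q : ℕ} (v : VectorSpinor q) :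
    cliffordCLM 1 (cliffordCLM 0 v) = -cliffordCLM 0 (cliffordCLM 1 v) := by
  ext ⟨b, i⟩
  fin_cases b <;> simp [cliffordCLM_apply, cliffordMul, cliffordMatrix]

/-- The radial profile of a regularisation at scale `δ` of the vector field `x / |x|²`, as a
function of `|x|²`. -/
noncomputable def radialProfile (δ s : ℝ) : ℝ := Real.smoothTransition (2 * s / δ ^ 2 - 1) * s⁻¹

theorem mul_radialProfile (δ s : ℝ) :
    s * radialProfile δ s = Real.smoothTransition (2 * s / δ ^ 2 - 1) := by
  rcases eq_or_ne s 0 with h | h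
  · rw [h, zero_mul, Real.smoothTransition.zero_of_nonpos]
    norm_num
  · rw [radialProfile]
    field_simp

theorem abs_radialProfile_le (δ s : ℝ) : |radialProfile δ s| ≤ |s|⁻¹ := by
  rw [radialProfile, abs_mul, abs_inv, abs_of_nonneg (Real.smoothTransition.nonneg _)]
  exact mul_le_of_le_one_left (by positivity) (Real.smoothTransition.le_one _)

/-- The transition factor vanishes for `s ≤ δ²/2`, so the singularity of `s⁻¹` at the origin is
never seen. -/
theorem contDiff_radialProfile {δ : ℝ} (hδ : 0 < δ) : ContDiff ℝ ∞ (radialProfile δ) := by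
  rw [contDiff_iff_contDiffAt]
  intro s
  rcases eq_or_ne s 0 with h | h
  · have h0 : radialProfile δ =ᶠ[nhds s] fun _ => 0 := by
      rw [h]
      filter_upwards [Iio_mem_nhds (show (0 : ℝ) < δ ^ 2 / 2 by positivity)] with t ht
      have ht' : 2 * t / δ ^ 2 - 1 ≤ 0 := by
        rw [sub_nonpos, div_le_one (by positivity)]
        have := Set.mem_Iio.1 ht
        linarith
      rw [radialProfile, Real.smoothTransition.zero_of_nonpos ht', zero_mul]
    exact contDiffAt_const.congr_of_eventuallyEq h0
  · refine ContDiffAt.mul ?_ (contDiffAt_inv ℝ h)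
    exact Real.smoothTransition.contDiff.contDiffAt.comp s (by fun_prop)

/-- The divergence of the regularised vector field, an approximate identity. -/
noncomputable def radialKernel (δ : ℝ) (x : Plane) : ℝ :=
  4 / δ ^ 2 * deriv Real.smoothTransition (2 * ‖x‖ ^ 2 / δ ^ 2 - 1)

/-- With `F` the profile, `2 F + 2 s F' = 2 (s F)'`, and `s F` is just the rescaled transition
function. -/
theorem radialKernel_eq {δ : ℝ} (hδ : 0 < δ) (x : Plane) :
    radialKernel δ x = 2 * radialProfile δ (‖x‖ ^ 2)
      + 2 * ‖x‖ ^ 2 * deriv (radialProfile δ) (‖x‖ ^ 2) := by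
  have h1 : HasDerivAt (fun s => s * radialProfile δ s)
      (1 * radialProfile δ (‖x‖ ^ 2) + ‖x‖ ^ 2 * deriv (radialProfile δ) (‖x‖ ^ 2)) (‖x‖ ^ 2) :=
    (hasDerivAt_id _).mul (((contDiff_radialProfile hδ).differentiable (by simp)).differentiableAt
      |>.hasDerivAt)
  have h2 : HasDerivAt (fun s => Real.smoothTransition (2 * s / δ ^ 2 - 1))
      (deriv Real.smoothTransition (2 * ‖x‖ ^ 2 / δ ^ 2 - 1) * (2 * 1 / δ ^ 2)) (‖x‖ ^ 2) := by
    refine HasDerivAt.comp (‖x‖ ^ 2)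
      ((Real.smoothTransition.contDiff (n := 1)).differentiable (by simp)).differentiableAt.hasDerivAt ?_
    exact (((hasDerivAt_id (‖x‖ ^ 2)).const_mul 2).div_const _).sub_const _
  simp_rw [mul_radialProfile] at h1
  have h3 := h1.unique h2
  rw [radialKernel]
  linear_combination -2 * h3

theorem continuous_deriv_smoothTransition : Continuous (deriv Real.smoothTransition) :=
  (Real.smoothTransition.contDiff (n := 1)).continuous_deriv le_rfl

theorem continuous_radialKernel (δ : ℝ) : Continuous (radialKernel δ) := by
  have := continuous_deriv_smoothTransition
  unfold radialKernel
  fun_prop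

theorem deriv_smoothTransition_eq_zero {t : ℝ} (ht : t ∉ Set.Icc (0 : ℝ) 1) :
    deriv Real.smoothTransition t = 0 := by
  rw [Set.mem_Icc, not_and_or, not_le, not_le] at ht
  rcases ht with ht | ht
  · have h : Real.smoothTransition =ᶠ[nhds t] fun _ => 0 := by
      filter_upwards [Iio_mem_nhds ht] with s hs
      exact Real.smoothTransition.zero_of_nonpos (Set.mem_Iio.1 hs).le
    rw [h.deriv_eq, deriv_const]
  · have h : Real.smoothTransition =ᶠ[nhds t] fun _ => 1 := by
      filter_upwards [Ioi_mem_nhds ht] with s hs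
      exact Real.smoothTransition.one_of_one_le (Set.mem_Ioi.1 hs).le
    rw [h.deriv_eq, deriv_const]

theorem exists_abs_radialKernel_le :
    ∃ B : ℝ, 0 ≤ B ∧ ∀ δ x, |radialKernel δ x| ≤ B / δ ^ 2 := by
  have hc : HasCompactSupport (deriv Real.smoothTransition) :=
    HasCompactSupport.intro isCompact_Icc fun t ht => deriv_smoothTransition_eq_zero ht
  obtain ⟨B, hB⟩ := hc.exists_bound_of_continuous continuous_deriv_smoothTransition
  refine ⟨4 * B, by linarith [(norm_nonneg _).trans (hB 0)], fun δ x => ?_⟩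
  rw [radialKernel, abs_mul, abs_of_nonneg (by positivity)]
  calc _ ≤ 4 / δ ^ 2 * B := by
        gcongr
        exact hB _
    _ = _ := by ring

theorem radialKernel_eq_zero {δ : ℝ} (hδ : 0 < δ) {x : Plane} (hx : δ < ‖x‖) :
    radialKernel δ x = 0 := by
  rw [radialKernel, deriv_smoothTransition_eq_zero, mul_zero]
  rw [Set.mem_Icc, not_and_or]
  right
  have : 1 < ‖x‖ ^ 2 / δ ^ 2 := by
    rw [one_lt_div (by positivity)]
    gcongr
  rw [mul_div_assoc]
  linarith

/-- In polar coordinates the radial integrand `r ρ(r)` is the derivative of the transition function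
along `r`, which rises from `0` to `1`. The total mass is therefore independent of `δ`. -/
theorem integral_radialKernel {δ : ℝ} (hδ : 0 < δ) :
    ∫ x, radialKernel δ x = 2 * (volume : Measure Plane).real (Metric.ball 0 1) := by
  have hd : ∀ r ∈ Set.Ici (0 : ℝ),
      HasDerivAt (fun r : ℝ => Real.smoothTransition (2 * r ^ 2 / δ ^ 2 - 1))
        (r * (4 / δ ^ 2 * deriv Real.smoothTransition (2 * r ^ 2 / δ ^ 2 - 1))) r := by
    intro r _
    have h1 : HasDerivAt (fun r : ℝ => 2 * r ^ 2 / δ ^ 2 - 1) (4 * r / δ ^ 2) r := by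
      refine ((((hasDerivAt_pow 2 r).const_mul 2).div_const (δ ^ 2)).sub_const 1).congr_deriv ?_
      norm_num
      ring
    have h2 := HasDerivAt.comp r ((Real.smoothTransition.contDiff (n := 1)).differentiable
      (by simp)).differentiableAt.hasDerivAt h1
    exact h2.congr_deriv (by ring)
  have hnn : ∀ r ∈ Set.Ioi (0 : ℝ),
      0 ≤ r * (4 / δ ^ 2 * deriv Real.smoothTransition (2 * r ^ 2 / δ ^ 2 - 1)) := by
    intro r hr
    have := Real.smoothTransition.monotone.deriv_nonneg (x := 2 * r ^ 2 / δ ^ 2 - 1)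
    have hr' : 0 < r := hr
    positivity
  have hlim : Filter.Tendsto (fun r : ℝ => Real.smoothTransition (2 * r ^ 2 / δ ^ 2 - 1))
      Filter.atTop (nhds 1) := by
    refine tendsto_const_nhds.congr' ?_
    filter_upwards [Filter.eventually_ge_atTop δ] with r hr
    rw [Real.smoothTransition.one_of_one_le]
    have : 1 ≤ r ^ 2 / δ ^ 2 := by
      rw [one_le_div (by positivity)]
      gcongr
    rw [mul_div_assoc]
    linarith
  have hi := integral_Ioi_of_hasDerivAt_of_nonneg' hd hnn hlim
  have h := integral_fun_norm_addHaar (volume : Measure Plane)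
    (fun r => 4 / δ ^ 2 * deriv Real.smoothTransition (2 * r ^ 2 / δ ^ 2 - 1))
  simp only [finrank_euclideanSpace_fin, smul_eq_mul, Nat.reduceSub, pow_one] at h
  rw [hi] at h
  unfold radialKernel
  rw [h, Real.smoothTransition.zero_of_nonpos (by norm_num)]
  simp

/-- A regularised fundamental solution of the Dirac operator with pole `x₀`. -/
noncomputable def diracPotential {q : ℕ} (δ : ℝ) (x₀ : Plane) (e : VectorSpinor q) (x : Plane) :
    VectorSpinor q :=
  -∑ α : Fin 2, ((x - x₀) α * radialProfile δ (‖x - x₀‖ ^ 2)) • cliffordCLM α e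

theorem contDiff_diracPotential {q : ℕ} {δ : ℝ} (hδ : 0 < δ) (x₀ : Plane) (e : VectorSpinor q) :
    ContDiff ℝ ∞ (diracPotential δ x₀ e) := by
  have h1 : ContDiff ℝ ∞ fun x : Plane => radialProfile δ (‖x - x₀‖ ^ 2) :=
    (contDiff_radialProfile hδ).comp ((contDiff_id.sub contDiff_const).norm_sq ℝ)
  have h2 : ∀ α : Fin 2, ContDiff ℝ ∞ fun x : Plane => (x - x₀) α := fun α =>
    (EuclideanSpace.proj (𝕜 := ℝ) α).contDiff.comp (contDiff_id.sub contDiff_const)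
  exact (ContDiff.sum fun α _ => ((h2 α).mul h1).smul contDiff_const).neg

theorem hasFDerivAt_coord_mul_radialProfile {δ : ℝ} (hδ : 0 < δ) (x₀ x : Plane) (α : Fin 2) :
    HasFDerivAt (fun x : Plane => (x - x₀) α * radialProfile δ (‖x - x₀‖ ^ 2))
      ((x - x₀) α • (deriv (radialProfile δ) (‖x - x₀‖ ^ 2) • (2 • innerSL ℝ (x - x₀)))
        + radialProfile δ (‖x - x₀‖ ^ 2) • EuclideanSpace.proj (𝕜 := ℝ) α) x := by
  have h1 : HasFDerivAt (fun x : Plane => (x - x₀) α) (EuclideanSpace.proj (𝕜 := ℝ) α) x :=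
    (EuclideanSpace.proj (𝕜 := ℝ) α).hasFDerivAt.comp x ((hasFDerivAt_id x).sub_const x₀)
  have h2 : HasFDerivAt (fun x : Plane => ‖x - x₀‖ ^ 2) (2 • innerSL ℝ (x - x₀)) x := by
    have := ((hasFDerivAt_id x).sub_const x₀).norm_sq
    simpa using this
  have h3 : HasDerivAt (radialProfile δ) (deriv (radialProfile δ) (‖x - x₀‖ ^ 2)) (‖x - x₀‖ ^ 2) :=
    ((contDiff_radialProfile hδ).differentiable (by simp)).differentiableAt.hasDerivAt
  have h4 : HasFDerivAt (fun x : Plane => radialProfile δ (‖x - x₀‖ ^ 2))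
      (deriv (radialProfile δ) (‖x - x₀‖ ^ 2) • (2 • innerSL ℝ (x - x₀))) x :=
    HasDerivAt.comp_hasFDerivAt (f := fun x : Plane => ‖x - x₀‖ ^ 2) x h3 h2
  exact h1.mul h4

/-- For `y = x - x₀` and `α ≠ β` the derivative `∂_α (y_β F) = 2 y_α y_β F'` is symmetric in the
indices, so anticommutation kills the mixed terms. The diagonal terms carry `e_α² = -1`, which the
sign in the potential cancels, and they add up to the divergence `2 F + 2 |y|² F'`. -/
theorem diracOp_diracPotential {q : ℕ} {δ : ℝ} (hδ : 0 < δ) (x₀ : Plane) (e : VectorSpinor q)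
    (x : Plane) : diracOp (diracPotential δ x₀ e) x = radialKernel δ (x - x₀) • e := by
  have h : HasFDerivAt (diracPotential δ x₀ e) _ x :=
    (HasFDerivAt.fun_sum fun α (_ : α ∈ Finset.univ) =>
      (hasFDerivAt_coord_mul_radialProfile hδ x₀ x α).smul_const (cliffordCLM α e)).neg
  rw [diracOp, h.fderiv, radialKernel_eq hδ]
  set y := x - x₀
  have hn : ‖y‖ ^ 2 = y 0 ^ 2 + y 1 ^ 2 := by
    rw [EuclideanSpace.norm_sq_eq]
    simp [Fin.sum_univ_two]
  set F := radialProfile δ (‖y‖ ^ 2)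
  set F' := deriv (radialProfile δ) (‖y‖ ^ 2)
  have hin : ∀ α : Fin 2, inner ℝ y (EuclideanSpace.single α (1 : ℝ)) = y α := by
    intro α
    simp [EuclideanSpace.inner_single_right]
  simp only [Fin.sum_univ_two, ← cliffordCLM_apply]
  simp [hin, cliffordMul_cliffordMul_self, cliffordMul_one_cliffordMul_zero, hn]
  module

/-- The bound is uniform in `δ`, as the limit `δ → 0` requires. -/
theorem norm_diracPotential_le {q : ℕ} (δ : ℝ) (x₀ : Plane) (e : VectorSpinor q) (x : Plane) :
    ‖diracPotential δ x₀ e x‖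
      ≤ (∑ α : Fin 2, ‖(cliffordCLM α : VectorSpinor q →L[ℝ] VectorSpinor q)‖) *
        (‖e‖ * ‖x - x₀‖⁻¹) := by
  rw [diracPotential, norm_neg, Finset.sum_mul]
  refine (norm_sum_le _ _).trans (Finset.sum_le_sum fun α _ => ?_)
  rw [norm_smul, Real.norm_eq_abs, abs_mul]
  have h1 : |(x - x₀) α| ≤ ‖x - x₀‖ := PiLp.norm_apply_le (x - x₀) α
  have h2 : |radialProfile δ (‖x - x₀‖ ^ 2)| ≤ (‖x - x₀‖ ^ 2)⁻¹ := by
    have := abs_radialProfile_le δ (‖x - x₀‖ ^ 2)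
    rwa [abs_of_nonneg (sq_nonneg ‖x - x₀‖)] at this
  have h3 : ‖x - x₀‖ * (‖x - x₀‖ ^ 2)⁻¹ = ‖x - x₀‖⁻¹ := by
    rcases eq_or_ne ‖x - x₀‖ 0 with h | h
    · simp [h]
    · field_simp
  calc _ ≤ (‖x - x₀‖ * (‖x - x₀‖ ^ 2)⁻¹) * (‖cliffordCLM α‖ * ‖e‖) := by
        gcongr
        exact ContinuousLinearMap.le_opNorm _ _
    _ = _ := by rw [h3]; ring

/-! ### The integral inequality for the cut-off solution -/

/-- A smooth cutoff function supported in the disc of radius `1 / 2`. -/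
noncomputable def discCutoff : ContDiffBump (0 : Plane) where
  rIn := 1 / 4
  rOut := 1 / 2
  rIn_pos := by norm_num
  rIn_lt_rOut := by norm_num

theorem tsupport_discCutoff_subset : tsupport discCutoff ⊆ Disc 1 := by
  rw [discCutoff.tsupport_eq]
  exact Metric.closedBall_subset_ball (by norm_num [discCutoff])

theorem exists_norm_fderiv_discCutoff_le :
    ∃ B : ℝ, 0 ≤ B ∧ ∀ x, ‖fderiv ℝ discCutoff x‖ ≤ B := by
  obtain ⟨B, hB⟩ := (discCutoff.hasCompactSupport.fderiv (𝕜 := ℝ)).exists_bound_of_continuous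
    (discCutoff.contDiff (n := 1) |>.continuous_fderiv (by simp))
  exact ⟨B, (norm_nonneg _).trans (hB 0), hB⟩

theorem diracOp_smul {q : ℕ} {χ : Plane → ℝ} {u : Plane → VectorSpinor q} {x : Plane}
    (hχ : DifferentiableAt ℝ χ x) (hu : DifferentiableAt ℝ u x) :
    diracOp (fun x => χ x • u x) x = χ x • diracOp u x
      + ∑ α : Fin 2, fderiv ℝ χ x (EuclideanSpace.single α 1) • cliffordCLM α (u x) := by
  simp only [diracOp, ← cliffordCLM_apply]
  rw [fderiv_fun_smul hχ hu, Finset.smul_sum, ← Finset.sum_add_distrib]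
  refine Finset.sum_congr rfl fun α _ => ?_
  simp

theorem integrable_inner_of_continuous {q : ℕ} {U : Set Plane} {ψ g : Plane → VectorSpinor q}
    (hψ : IntegrableOn ψ U) (hg : Continuous g) (hc : HasCompactSupport g) :
    IntegrableOn (fun x => inner ℂ (ψ x) (g x)) U := by
  obtain ⟨B, hB⟩ := hc.exists_bound_of_continuous hg
  refine (hψ.norm.mul_const B).mono' (hψ.1.inner hg.aestronglyMeasurable) ?_
  refine Filter.Eventually.of_forall fun x => (norm_inner_le_norm _ _).trans ?_
  gcongr
  exact hB x

/-- The test field is the cutoff times the potential whose constant vector is the integral `Φ` being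
estimated. The main term is then `|Φ|²`, the other terms are linear in `|Φ|`, and one factor
cancels. No decomposition into components is needed. -/
theorem enorm_integral_radialKernel_le (q : ℕ) :
    ∃ C : ℝ≥0, ∀ (A : Plane → VectorSpinor q →L[ℝ] VectorSpinor q) (ψ : Plane → VectorSpinor q),
      IntegrableOn ψ (Disc 1) → IsWeakDiracSolution (Disc 1) A ψ →
      ∀ (δ : ℝ) (x₀ : Plane), 0 < δ →
      ‖∫ x in Disc 1, (radialKernel δ (x - x₀) * discCutoff x) • ψ x‖ₑ
        ≤ C * ∫⁻ x in Disc 1,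
            (‖A x‖ₑ * ‖discCutoff x • ψ x‖ₑ + ‖ψ x‖ₑ) * (edist x₀ x)⁻¹ := by
  obtain ⟨B, hB0, hB⟩ := exists_norm_fderiv_discCutoff_le
  set S : ℝ := ∑ α : Fin 2, ‖(cliffordCLM α : VectorSpinor q →L[ℝ] VectorSpinor q)‖ with hS
  have hS0 : 0 ≤ S := Finset.sum_nonneg fun _ _ => norm_nonneg _
  refine ⟨(S + B * S * S).toNNReal, fun A ψ hψ hweak δ x₀ hδ => ?_⟩
  set Φ := ∫ x in Disc 1, (radialKernel δ (x - x₀) * discCutoff x) • ψ x with hΦ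
  set J := ∫⁻ x in Disc 1, (‖A x‖ₑ * ‖discCutoff x • ψ x‖ₑ + ‖ψ x‖ₑ) * (edist x₀ x)⁻¹ with hJ
  rcases eq_or_ne Φ 0 with h0 | h0
  · rw [h0, enorm_zero]
    exact zero_le
  set u := diracPotential δ x₀ Φ with hu_def
  have hu : ContDiff ℝ ∞ u := contDiff_diracPotential hδ x₀ Φ
  have hχ : ContDiff ℝ ∞ discCutoff := discCutoff.contDiff
  set η : Plane → VectorSpinor q := fun x => discCutoff x • u x with hη_def
  have hη : ContDiff ℝ ∞ η := hχ.smul hu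
  have hηc : HasCompactSupport η := discCutoff.hasCompactSupport.smul_right
  have hηs : tsupport η ⊆ Disc 1 :=
    (tsupport_smul_subset_left _ _).trans tsupport_discCutoff_subset
  -- The error from differentiating the cutoff; it produces the term with `|ψ|` and no `A`.
  set R : Plane → VectorSpinor q := fun x =>
    ∑ α : Fin 2, fderiv ℝ discCutoff x (EuclideanSpace.single α 1) • cliffordCLM α (u x) with hR_def
  set P : Plane → VectorSpinor q := fun x =>
    (radialKernel δ (x - x₀) * discCutoff x) • Φ with hP_def
  have hD : ∀ x, diracOp η x = P x + R x := by
    intro x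
    rw [hη_def, diracOp_smul (hχ.differentiable (by simp)).differentiableAt
      (hu.differentiable (by simp)).differentiableAt, hu_def, diracOp_diracPotential hδ, smul_smul,
      mul_comm (discCutoff x)]
  have hRcont : Continuous R := by
    have h1 : Continuous (fderiv ℝ discCutoff) := hχ.continuous_fderiv (by simp)
    have h2 : Continuous u := hu.continuous
    exact continuous_finsetSum _ fun α _ => (h1.clm_apply continuous_const).smul
      ((cliffordCLM α).continuous.comp h2)
  have hRc : HasCompactSupport R := by
    refine HasCompactSupport.intro discCutoff.hasCompactSupport fun x hx => ?_
    have : fderiv ℝ discCutoff x = 0 := by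
      by_contra hne
      exact hx (support_fderiv_subset ℝ hne)
    simp [hR_def, this]
  have hPcont : Continuous P := by
    have h1 := continuous_radialKernel δ
    have h2 : Continuous discCutoff := discCutoff.continuous
    fun_prop
  have hPc : HasCompactSupport P := by
    refine HasCompactSupport.intro discCutoff.hasCompactSupport fun x hx => ?_
    simp [hP_def, image_eq_zero_of_notMem_tsupport hx]
  have hPi := integrable_inner_of_continuous hψ hPcont hPc
  have hRi := integrable_inner_of_continuous hψ hRcont hRc
  have heq := hweak η hη hηc hηs
  simp_rw [hD, inner_add_right] at heq
  rw [integral_add hPi hRi] at heq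
  have hkψ : IntegrableOn (fun x => (radialKernel δ (x - x₀) * discCutoff x) • ψ x) (Disc 1) := by
    obtain ⟨K, hK⟩ := (discCutoff.hasCompactSupport.mul_left
      (f := fun x => radialKernel δ (x - x₀))).exists_bound_of_continuous
      (((continuous_radialKernel δ).comp (continuous_sub_right x₀)).mul discCutoff.continuous)
    exact hψ.bdd_smul K (((continuous_radialKernel δ).comp (continuous_sub_right x₀)).mul
      discCutoff.continuous).aestronglyMeasurable (Filter.Eventually.of_forall hK)
  have hPint : ‖∫ x in Disc 1, inner ℂ (ψ x) (P x)‖ₑ = ‖Φ‖ₑ * ‖Φ‖ₑ := by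
    have h1 : ∫ x in Disc 1, inner ℂ (ψ x) (P x) = (starRingEnd ℂ) (inner ℂ Φ Φ) := by
      conv_rhs => rw [hΦ, ← integral_inner hkψ, ← integral_conj]
      refine integral_congr_ae (Filter.Eventually.of_forall fun x => ?_)
      simp only [hP_def, inner_conj_symm]
      rw [← Complex.coe_smul, ← Complex.coe_smul, inner_smul_left, inner_smul_right,
        Complex.conj_ofReal]
    rw [h1, inner_self_eq_norm_sq_to_K, ← enorm_norm, RCLike.norm_conj, norm_pow, ← enorm_norm Φ,
      ← enorm_mul]
    simp [pow_two]
  have huU : ∀ x, ‖u x‖ₑ ≤ ENNReal.ofReal S * ‖Φ‖ₑ * (edist x₀ x)⁻¹ := by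
    intro x
    -- At the pole the inverse distance is `⊤`, so the bound is trivial unless `S = 0`, and then `u`
    -- vanishes.
    rcases eq_or_ne x₀ x with hx | hx
    · rw [← hx, edist_self, ENNReal.inv_zero]
      rcases eq_or_ne S 0 with hS1 | hS1
      · have := norm_diracPotential_le δ x₀ Φ x
        rw [← hS, hS1, zero_mul] at this
        have h2 : u x = 0 := norm_le_zero_iff.1 this
        rw [← hx] at h2
        rw [h2, enorm_zero]
        exact zero_le
      · rw [ENNReal.mul_top]
        · exact le_top
        · refine mul_ne_zero ?_ (by simpa using h0)
          simpa using lt_of_le_of_ne hS0 hS1.symm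
    · have hd : 0 < ‖x - x₀‖ := norm_pos_iff.2 (sub_ne_zero.2 hx.symm)
      have h1 := ENNReal.ofReal_le_ofReal (norm_diracPotential_le δ x₀ Φ x)
      rw [← hS, ENNReal.ofReal_mul hS0, ENNReal.ofReal_mul (norm_nonneg _), ofReal_norm,
        ofReal_norm, ENNReal.ofReal_inv_of_pos hd, ofReal_norm, ← mul_assoc] at h1
      rwa [edist_comm, edist_eq_enorm_sub]
  have hRu : ∀ x, ‖R x‖ₑ ≤ ENNReal.ofReal (B * S) * ‖u x‖ₑ := by
    intro x
    rw [← ofReal_norm, ← ofReal_norm, ← ENNReal.ofReal_mul (by positivity)]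
    refine ENNReal.ofReal_le_ofReal ?_
    rw [hS, Finset.mul_sum, Finset.sum_mul]
    refine (norm_sum_le _ _).trans (Finset.sum_le_sum fun α _ => ?_)
    rw [norm_smul, mul_assoc]
    gcongr
    · refine ((fderiv ℝ discCutoff x).le_opNorm _).trans ?_
      simpa using hB x
    · exact ContinuousLinearMap.le_opNorm _ _
  have hmain : ‖Φ‖ₑ * ‖Φ‖ₑ ≤ ‖Φ‖ₑ * ((S + B * S * S).toNNReal * J) := by
    rw [← hPint, eq_sub_of_add_eq heq]
    calc _ ≤ ‖∫ x in Disc 1, inner ℂ (A x (ψ x)) (η x)‖ₑ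
          + ‖∫ x in Disc 1, inner ℂ (ψ x) (R x)‖ₑ := enorm_sub_le
      _ ≤ (∫⁻ x in Disc 1, ‖inner ℂ (A x (ψ x)) (η x)‖ₑ)
          + ∫⁻ x in Disc 1, ‖inner ℂ (ψ x) (R x)‖ₑ :=
        add_le_add (enorm_integral_le_lintegral_enorm _) (enorm_integral_le_lintegral_enorm _)
      _ = ∫⁻ x in Disc 1, (‖inner ℂ (A x (ψ x)) (η x)‖ₑ + ‖inner ℂ (ψ x) (R x)‖ₑ) :=
        (lintegral_add_right' _ hRi.1.enorm).symm
      _ ≤ ∫⁻ x in Disc 1, ‖Φ‖ₑ * (S + B * S * S).toNNReal *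
            ((‖A x‖ₑ * ‖discCutoff x • ψ x‖ₑ + ‖ψ x‖ₑ) * (edist x₀ x)⁻¹) := by
        refine lintegral_mono fun x => ?_
        have hinner : ∀ v w : VectorSpinor q, ‖inner ℂ v w‖ₑ ≤ ‖v‖ₑ * ‖w‖ₑ := by
          intro v w
          rw [← ofReal_norm, ← ofReal_norm, ← ofReal_norm, ← ENNReal.ofReal_mul (norm_nonneg _)]
          exact ENNReal.ofReal_le_ofReal (norm_inner_le_norm _ _)
        have hAψ : ‖A x (ψ x)‖ₑ ≤ ‖A x‖ₑ * ‖ψ x‖ₑ := (A x).le_opENorm _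
        have h1 : ENNReal.ofReal S ≤ (S + B * S * S).toNNReal :=
          ENNReal.ofReal_le_ofReal (le_add_of_nonneg_right (by positivity))
        have h2 : ENNReal.ofReal (B * S) * ENNReal.ofReal S ≤ (S + B * S * S).toNNReal := by
          rw [← ENNReal.ofReal_mul (by positivity)]
          exact ENNReal.ofReal_le_ofReal (le_add_of_nonneg_left hS0)
        calc ‖inner ℂ (A x (ψ x)) (η x)‖ₑ + ‖inner ℂ (ψ x) (R x)‖ₑ
            ≤ (‖A x‖ₑ * ‖ψ x‖ₑ) * (‖discCutoff x‖ₑ *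
                (ENNReal.ofReal S * ‖Φ‖ₑ * (edist x₀ x)⁻¹))
              + ‖ψ x‖ₑ * (ENNReal.ofReal (B * S) *
                (ENNReal.ofReal S * ‖Φ‖ₑ * (edist x₀ x)⁻¹)) := by
              refine add_le_add ((hinner _ _).trans (mul_le_mul' hAψ ?_))
                ((hinner _ _).trans (mul_le_mul_right ((hRu x).trans
                  (mul_le_mul_right (huU x) _)) _))
              simp only [hη_def]
              rw [enorm_smul]
              exact mul_le_mul_right (huU x) _
          _ = ‖Φ‖ₑ * ((‖A x‖ₑ * (‖discCutoff x‖ₑ * ‖ψ x‖ₑ)) * ENNReal.ofReal S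
                + ‖ψ x‖ₑ * (ENNReal.ofReal (B * S) * ENNReal.ofReal S)) * (edist x₀ x)⁻¹ := by
              ring
          _ ≤ ‖Φ‖ₑ * ((‖A x‖ₑ * (‖discCutoff x‖ₑ * ‖ψ x‖ₑ)) * (S + B * S * S).toNNReal
                + ‖ψ x‖ₑ * (S + B * S * S).toNNReal) * (edist x₀ x)⁻¹ := by
              gcongr
          _ = _ := by
              rw [enorm_smul]
              ring
      _ = _ := by
        rw [lintegral_const_mul' _ _ (by finiteness), mul_assoc]
  exact (ENNReal.mul_le_mul_iff_right (by simpa using h0) (by simp)).1 hmain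

/-- Lebesgue differentiation. The kernel has fixed mass, is at most `B / δ²`, and lives on a ball of
area at most `4 δ²`, so the error is at most `4 B` times the mean oscillation of `φ` about `φ x₀`.
-/
theorem ae_tendsto_integral_radialKernel_smul {q : ℕ} {φ : Plane → VectorSpinor q}
    (hφ : Integrable φ) : ∀ᵐ x₀, Filter.Tendsto
      (fun n : ℕ => ∫ x, radialKernel (1 / (n + 1)) (x - x₀) • φ x) Filter.atTop
      (nhds ((2 * (volume : Measure Plane).real (Metric.ball 0 1)) • φ x₀)) := by
  obtain ⟨B, hB0, hB⟩ := exists_abs_radialKernel_le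
  filter_upwards [IsUnifLocDoublingMeasure.ae_tendsto_average_norm_sub volume
    hφ.locallyIntegrable 1] with x₀ h₀
  have hδ : ∀ n : ℕ, 0 < (1 / (n + 1) : ℝ) := fun n => by positivity
  have hav := h₀ (fun _ : ℕ => x₀) (fun n : ℕ => (1 / (n + 1) : ℝ))
    (tendsto_nhdsWithin_iff.2 ⟨tendsto_one_div_add_atTop_nhds_zero_nat,
      Filter.Eventually.of_forall hδ⟩)
    (Filter.Eventually.of_forall fun n => Metric.mem_closedBall_self (by positivity))
  have hlim := hav.const_mul (4 * B)
  rw [mul_zero] at hlim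
  rw [tendsto_iff_norm_sub_tendsto_zero]
  refine squeeze_zero (fun _ => norm_nonneg _) (fun n => ?_) hlim
  set δ : ℝ := 1 / (n + 1) with hδ_def
  have hδn : 0 < δ := hδ n
  set ρ : Plane → ℝ := fun x => radialKernel δ (x - x₀) with hρ
  have hρc : Continuous ρ := (continuous_radialKernel δ).comp (continuous_sub_right x₀)
  have hρ0 : ∀ x ∉ Metric.closedBall x₀ δ, ρ x = 0 := by
    intro x hx
    refine radialKernel_eq_zero hδn ?_
    simpa [dist_eq_norm] using hx
  have hρs : HasCompactSupport ρ := HasCompactSupport.intro (isCompact_closedBall x₀ δ) hρ0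
  have hρi : Integrable ρ := hρc.integrable_of_hasCompactSupport hρs
  have hρb : ∀ x, ‖ρ x‖ ≤ B / δ ^ 2 := fun x => hB δ (x - x₀)
  have h1 : Integrable fun x => ρ x • φ x :=
    hφ.bdd_smul _ hρc.aestronglyMeasurable (Filter.Eventually.of_forall hρb)
  have hκ : ∫ x, ρ x = 2 * (volume : Measure Plane).real (Metric.ball 0 1) := by
    rw [← integral_radialKernel hδn]
    exact integral_sub_right_eq_self (radialKernel δ) x₀
  have e1 : (∫ x, ρ x • φ x) - (2 * (volume : Measure Plane).real (Metric.ball 0 1)) • φ x₀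
      = ∫ x in Metric.closedBall x₀ δ, ρ x • (φ x - φ x₀) := by
    rw [← hκ, ← integral_smul_const, ← integral_sub h1 (hρi.smul_const _)]
    simp_rw [← smul_sub]
    rw [setIntegral_eq_integral_of_forall_compl_eq_zero]
    intro x hx
    rw [hρ0 x hx, zero_smul]
  have hloc : IntegrableOn (fun x => φ x - φ x₀) (Metric.closedBall x₀ δ) :=
    hφ.integrableOn.sub (integrableOn_const (measure_closedBall_lt_top.ne))
  have hvol : (volume : Measure Plane).real (Metric.closedBall x₀ δ) ≤ 4 * δ ^ 2 := by
    rw [Measure.real, Measure.addHaar_closedBall_eq_addHaar_ball]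
    refine ENNReal.toReal_le_of_le_ofReal (by positivity) ?_
    rw [ENNReal.ofReal_mul (by norm_num), ENNReal.ofReal_ofNat]
    exact Plane.volume_ball_le x₀ hδn.le
  have hvol0 : 0 < (volume : Measure Plane).real (Metric.closedBall x₀ δ) :=
    ENNReal.toReal_pos (Metric.measure_closedBall_pos volume x₀ hδn).ne'
      measure_closedBall_lt_top.ne
  rw [e1]
  calc ‖∫ x in Metric.closedBall x₀ δ, ρ x • (φ x - φ x₀)‖
      ≤ ∫ x in Metric.closedBall x₀ δ, B / δ ^ 2 * ‖φ x - φ x₀‖ := by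
        refine norm_integral_le_of_norm_le (hloc.norm.const_mul _)
          (Filter.Eventually.of_forall fun x => ?_)
        rw [norm_smul]
        gcongr
        exact hρb x
    _ = B / δ ^ 2 * ((volume : Measure Plane).real (Metric.closedBall x₀ δ) *
          ⨍ x in Metric.closedBall x₀ δ, ‖φ x - φ x₀‖) := by
        rw [integral_const_mul, setAverage_eq, smul_eq_mul, mul_inv_cancel_left₀ hvol0.ne']
    _ ≤ B / δ ^ 2 * ((4 * δ ^ 2) * ⨍ x in Metric.closedBall x₀ δ, ‖φ x - φ x₀‖) := by
        have : 0 ≤ ⨍ x in Metric.closedBall x₀ δ, ‖φ x - φ x₀‖ := by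
          rw [setAverage_eq]
          exact smul_nonneg (by positivity) (integral_nonneg fun _ => norm_nonneg _)
        gcongr
    _ = 4 * B * ⨍ x in Metric.closedBall x₀ δ, ‖φ x - φ x₀‖ := by
        field_simp

/-- A weak solution of the Dirac equation, cut off, is a subsolution of an integral inequality. -/
theorem ae_enorm_discCutoff_smul_le (q : ℕ) :
    ∃ C : ℝ≥0, ∀ (A : Plane → VectorSpinor q →L[ℝ] VectorSpinor q) (ψ : Plane → VectorSpinor q),
      IntegrableOn ψ (Disc 1) → IsWeakDiracSolution (Disc 1) A ψ →
      ∀ᵐ x₀, ‖(Disc 1).indicator (fun x => discCutoff x • ψ x) x₀‖ₑ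
        ≤ C * ∫⁻ x in Disc 1,
            (‖A x‖ₑ * ‖discCutoff x • ψ x‖ₑ + ‖ψ x‖ₑ) * (edist x₀ x)⁻¹ := by
  obtain ⟨C, hC⟩ := enorm_integral_radialKernel_le q
  set κ : ℝ := 2 * (volume : Measure Plane).real (Metric.ball 0 1) with hκ_def
  have hκ : 0 < κ := mul_pos two_pos (ENNReal.toReal_pos
    (Metric.measure_ball_pos volume 0 one_pos).ne' measure_ball_lt_top.ne)
  refine ⟨κ⁻¹.toNNReal * C, fun A ψ hψ hweak => ?_⟩
  have hφ : Integrable ((Disc 1).indicator fun x => discCutoff x • ψ x) := by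
    rw [integrable_indicator_iff measurableSet_ball]
    refine hψ.bdd_smul 1 discCutoff.continuous.aestronglyMeasurable
      (Filter.Eventually.of_forall fun x => ?_)
    rw [Real.norm_of_nonneg discCutoff.nonneg]
    exact discCutoff.le_one
  filter_upwards [ae_tendsto_integral_radialKernel_smul hφ] with x₀ hx₀
  -- The bound does not involve the regularisation scale and passes to the limit; the total mass `κ`
  -- of the kernel is divided out afterwards.
  have h := le_of_tendsto' (b := C * ∫⁻ x in Disc 1,
    (‖A x‖ₑ * ‖discCutoff x • ψ x‖ₑ + ‖ψ x‖ₑ) * (edist x₀ x)⁻¹) hx₀.enorm fun n => ?_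
  · rw [enorm_smul, Real.enorm_of_nonneg hκ.le] at h
    rw [ENNReal.coe_mul, mul_assoc]
    refine le_trans (le_of_eq ?_) (mul_le_mul_right h _)
    rw [← mul_assoc]
    change _ = ENNReal.ofReal κ⁻¹ * _ * _
    rw [← ENNReal.ofReal_mul (by positivity), inv_mul_cancel₀ hκ.ne', ENNReal.ofReal_one, one_mul]
  · refine le_trans (le_of_eq ?_) (hC A ψ hψ hweak (1 / (n + 1)) x₀ (by positivity))
    congr 1
    rw [← integral_indicator measurableSet_ball]
    refine integral_congr_ae (Filter.Eventually.of_forall fun x => ?_)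
    by_cases hx : x ∈ Disc 1
    · simp only [Set.indicator_of_mem hx, mul_smul]
    · simp only [Set.indicator_of_notMem hx, smul_zero]

/-! ### Conclusion -/

/-- Hölder with exponents `4` and `4/3`, as `|x|^(-4/3)` is locally integrable in the plane. It
turns the cutoff error into a constant multiple of the `L⁴` norm of `ψ`. -/
theorem exists_lintegral_disc_mul_edist_inv_le :
    ∃ C : ℝ≥0, ∀ (f : Plane → ℝ≥0∞) (x₀ : Plane), AEMeasurable f (volume.restrict (Disc 1)) →
      ∫⁻ x in Disc 1, f x * (edist x₀ x)⁻¹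
        ≤ C * (∫⁻ x in Disc 1, f x ^ (4 : ℝ)) ^ (1 / 4 : ℝ) := by
  obtain ⟨C, hC⟩ := lintegral_disc_edist_rpow_le (s := 4 / 3) (by norm_num) (by norm_num)
  refine ⟨C ^ (1 / (4 / 3) : ℝ), fun f x₀ hf => ?_⟩
  refine (ENNReal.lintegral_mul_le_Lp_mul_Lq (volume.restrict (Disc 1)) (p := 4) (q := 4 / 3)
    (by rw [Real.holderConjugate_iff]; norm_num) hf (g := fun x => (edist x₀ x)⁻¹)
    (by fun_prop)).trans ?_
  rw [mul_comm, ENNReal.coe_rpow_of_nonneg _ (by norm_num)]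
  gcongr
  simp_rw [ENNReal.inv_rpow, ← ENNReal.rpow_neg]
  exact hC x₀

theorem mainTheorem2 (q : ℕ) :
    ∃ ε : ℝ≥0, 0 < ε ∧ ∀ p : ℝ≥0, 4 < p → ∃ C : ℝ≥0,
      ∀ (A : Plane → VectorSpinor q →L[ℝ] VectorSpinor q) (ψ : Plane → VectorSpinor q),
        MemLp ψ 4 (volume.restrict (Disc 1)) →
        MemLp A 2 (volume.restrict (Disc 1)) →
        IsWeakDiracSolution (Disc 1) A ψ →
        eLpNorm A 2 (volume.restrict (Disc 1)) ≤ ε →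
        MemLp ψ p (volume.restrict (Disc (1 / 16))) ∧
          eLpNorm ψ p (volume.restrict (Disc (1 / 16)))
            ≤ C * eLpNorm ψ 4 (volume.restrict (Disc 1)) := by
  obtain ⟨C₁, h₁⟩ := ae_enorm_discCutoff_smul_le q
  obtain ⟨C₂, h₂⟩ := exists_lintegral_disc_mul_edist_inv_le
  -- One constant dominates both coefficients: `C₁` of the potential and `C₁ C₂` of the cutoff
  -- error.
  obtain ⟨ε, hε, hreg⟩ := lintegral_disc_rpow_le_of_le_potential (C₁ + C₁ * C₂)
  refine ⟨ε, hε, fun p hp => ?_⟩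
  have hp' : (4 : ℝ) < p := by exact_mod_cast hp
  obtain ⟨K, hK⟩ := hreg p hp'
  refine ⟨K, fun A ψ hψ hA hweak hAε => ?_⟩
  have hfin : IsFiniteMeasure (volume.restrict (Disc 1)) := ⟨by simp⟩
  have hψi : IntegrableOn ψ (Disc 1) := hψ.integrable (by norm_num)
  set N : ℝ≥0 := (eLpNorm ψ 4 (volume.restrict (Disc 1))).toNNReal with hN_def
  have hN : (N : ℝ≥0∞) = eLpNorm ψ 4 (volume.restrict (Disc 1)) :=
    ENNReal.coe_toNNReal hψ.2.ne
  have hN4 : (N : ℝ≥0∞) = (∫⁻ x in Disc 1, ‖ψ x‖ₑ ^ (4 : ℝ)) ^ (1 / 4 : ℝ) := by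
    rw [hN, eLpNorm_eq_lintegral_rpow_enorm_toReal (by norm_num) (by norm_num)]
    norm_num
  set φ : Plane → VectorSpinor q := (Disc 1).indicator fun x => discCutoff x • ψ x with hφ_def
  have hφm : AEStronglyMeasurable φ :=
    (aestronglyMeasurable_indicator_iff measurableSet_ball).2
      (discCutoff.continuous.aestronglyMeasurable.smul hψ.1)
  have ham : AEMeasurable ((Disc 1).indicator fun x => ‖A x‖ₑ) :=
    (aemeasurable_indicator_iff measurableSet_ball).2 hA.1.enorm
  set a := ham.mk with ha_def
  -- The indicator is applied again because a measurable representative vanishes off the disc only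
  -- almost everywhere, while `hK` asks for every point.
  set v := (Disc 1).indicator hφm.enorm.mk with hv_def
  have hve : ∀ᵐ x, v x = ‖φ x‖ₑ := by
    filter_upwards [hφm.enorm.ae_eq_mk] with x hx
    by_cases hxD : x ∈ Disc 1
    · rw [hv_def, Set.indicator_of_mem hxD, ← hx]
    · rw [hv_def, Set.indicator_of_notMem hxD, hφ_def, Set.indicator_of_notMem hxD, enorm_zero]
  have hae : ∀ᵐ x, a x = (Disc 1).indicator (fun x => ‖A x‖ₑ) x := by
    filter_upwards [ham.ae_eq_mk] with x hx
    exact hx.symm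
  have hφψ : ∀ x, ‖φ x‖ₑ ≤ (Disc 1).indicator (fun x => ‖ψ x‖ₑ) x := by
    intro x
    by_cases hx : x ∈ Disc 1
    · simp only [hφ_def, Set.indicator_of_mem hx]
      rw [enorm_smul, Real.enorm_of_nonneg discCutoff.nonneg]
      calc _ ≤ 1 * ‖ψ x‖ₑ := by
            gcongr
            exact ENNReal.ofReal_le_one.2 discCutoff.le_one
        _ = _ := one_mul _
    · simp [hφ_def, Set.indicator_of_notMem hx]
  have key := hK v a N (hφm.enorm.measurable_mk.indicator measurableSet_ball) ham.measurable_mk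
    ?_ ?_ ?_ ?_
  · have hle : eLpNorm ψ p (volume.restrict (Disc (1 / 16))) ≤ K * N := by
      have hp0 : (p : ℝ≥0∞) ≠ 0 := by
        have : p ≠ 0 := (lt_trans (by norm_num) hp).ne'
        exact_mod_cast this
      rw [eLpNorm_eq_lintegral_rpow_enorm_toReal hp0 ENNReal.coe_ne_top, ENNReal.coe_toReal]
      have h3 : ∫⁻ x in Disc (1 / 16), ‖ψ x‖ₑ ^ (p : ℝ) ≤ (K * N : ℝ≥0∞) ^ (p : ℝ) := by
        refine le_trans ?_ key
        calc ∫⁻ x in Disc (1 / 16), ‖ψ x‖ₑ ^ (p : ℝ)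
            = ∫⁻ x in Disc (1 / 16), v x ^ (p : ℝ) := by
              refine lintegral_congr_ae ?_
              rw [Filter.EventuallyEq, ae_restrict_iff' measurableSet_ball]
              filter_upwards [hve] with x hx hxD
              have hxD1 : x ∈ Disc 1 := Metric.ball_subset_ball (by norm_num) hxD
              -- The cutoff equals `1` on the ball of radius `1/4`, which contains the disc of
              -- radius `1/16`.
              rw [hx, hφ_def, Set.indicator_of_mem hxD1, discCutoff.one_of_mem_closedBall,
                one_smul]
              refine Metric.closedBall_subset_closedBall ?_ (Metric.ball_subset_closedBall hxD)
              norm_num [discCutoff]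
          _ ≤ ∫⁻ x in Disc 1, v x ^ (p : ℝ) :=
              lintegral_mono_set (Metric.ball_subset_ball (by norm_num))
      refine (ENNReal.rpow_le_rpow h3 (by positivity)).trans (le_of_eq ?_)
      rw [← ENNReal.rpow_mul, mul_one_div_cancel (by linarith), ENNReal.rpow_one]
    rw [← hN]
    refine ⟨⟨hψ.1.mono_measure (Measure.restrict_mono
      (Metric.ball_subset_ball (by norm_num)) le_rfl), ?_⟩, hle⟩
    exact hle.trans_lt (ENNReal.mul_lt_top ENNReal.coe_lt_top ENNReal.coe_lt_top)
  · rw [hN4, ← ENNReal.rpow_mul, one_div_mul_cancel (by norm_num), ENNReal.rpow_one,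
      ← lintegral_indicator measurableSet_ball]
    refine lintegral_mono_ae ?_
    filter_upwards [hve] with x hx
    rw [hx]
    refine (ENNReal.rpow_le_rpow (hφψ x) (by norm_num)).trans (le_of_eq ?_)
    by_cases hxD : x ∈ Disc 1
    · simp only [Set.indicator_of_mem hxD]
    · simp [Set.indicator_of_notMem hxD]
  · rw [eLpNorm_eq_lintegral_rpow_enorm_toReal (by norm_num) (by norm_num)] at hAε
    have h3 := ENNReal.rpow_le_rpow hAε (show (0 : ℝ) ≤ 2 by norm_num)
    rw [← ENNReal.rpow_mul] at h3
    norm_num at h3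
    norm_num
    refine le_trans (le_of_eq ?_) h3
    rw [← lintegral_indicator measurableSet_ball]
    refine lintegral_congr_ae ?_
    filter_upwards [hae] with x hx
    rw [hx]
    by_cases hxD : x ∈ Disc 1
    · simp only [Set.indicator_of_mem hxD]
    · simp [Set.indicator_of_notMem hxD]
  · intro x hx
    rw [hv_def, Set.indicator_of_notMem hx]
  · filter_upwards [h₁ A ψ hψi hweak, hve] with x hx hvx
    rw [hvx]
    refine hx.trans ?_
    have hψm : AEMeasurable (fun y => ‖ψ y‖ₑ * (edist x y)⁻¹) (volume.restrict (Disc 1)) :=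
      hψ.1.enorm.mul (by fun_prop)
    simp_rw [add_mul]
    rw [lintegral_add_right' _ hψm, mul_add, add_comm]
    have hI : ∫⁻ y in Disc 1, ‖A y‖ₑ * ‖discCutoff y • ψ y‖ₑ * (edist x y)⁻¹
        = ∫⁻ y, a y * v y * (edist x y)⁻¹ := by
      rw [← lintegral_indicator measurableSet_ball]
      refine lintegral_congr_ae ?_
      filter_upwards [hae, hve] with y hay hvy
      rw [hay, hvy]
      by_cases hy : y ∈ Disc 1
      · simp only [hφ_def, Set.indicator_of_mem hy]
      · simp [Set.indicator_of_notMem hy]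
    rw [hI]
    have h4 := h₂ (fun y => ‖ψ y‖ₑ) x hψ.1.enorm
    rw [← hN4] at h4
    push_cast
    refine add_le_add ?_ ?_
    · calc _ ≤ (C₁ : ℝ≥0∞) * (C₂ * N) := by gcongr
        _ = C₁ * C₂ * N := (mul_assoc _ _ _).symm
        _ ≤ _ := by
          gcongr
          exact le_add_self
    · gcongr
      exact le_self_add
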